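/- Let $d\ge 3$ and let $P\subset\mathbb R^d$ be a $d$-polytope. For a facet $F$ of $P$ let $H_F$ be the affine hyperplane spanned by $F$, let $H_F^+$ be the open half-space bounded by $H_F$ whose closure contains $P$, and let $H_F^-$ be the opposite open half-space; a point of $H_F^+$ (of $H_F^-$) lies *beneath* (*beyond*) $F$. Two facets are adjacent if their intersection is a ridge (a $(d-2)$-face), called the ridge between them; $\operatorname{adj}(F)$ is the set of facets of $P$ adjacent to $F$. Let $S$ be a simplex facet of $P$, that is, a facet combinatorially equivalent to a $(d-1)$-simplex, and let $S$ be in bounded position: any $d$ of the hyperplanes $H_F$, $F\in\operatorname{adj}(S)$, intersect in a single point, which lies in $H_S^-$. Let $\mathcal F,\mathcal N\subseteq\operatorname{adj}(S)$ be disjoint, and let $\mathcal F$ be nonsimple: there are no two adjacent facets $G,G'\in\mathcal F$ that have a common $(d-3)$-face with $S$. Let $v$ be a point that lies beyond $S$ and beyond all facets in $\mathcal N$, lies in $H_F$ for all $F\in\mathcal F$, and lies beneath all facets of $P$ outside $\{S\}\cup\mathcal F\cup\mathcal N$. Then $Q:=\operatorname{conv}(P\cup\{v\})$ is called the pseudo-stacking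 of $P$ above $S$ with respect to $\mathcal F$ and $\mathcal N$; the same definition is applied to a lower-dimensional polytope inside its affine span. The point $v$ is a vertex of $Q$ that does not belong to $P$, and the following holds. 1. The relative interiors of $S$ and of the facets in $\mathcal N$ lie in the interior of $Q$. 2. $Q$ has facets of the following four types, and no others: - (a) every facet of $P$ outside $\{S\}\cup\mathcal F\cup\mathcal N$ is also a facet of $Q$; - (b) for every ridge $R$ between $S$ and a facet in $\operatorname{adj}(S)\setminus(\mathcal F\cup\mathcal N)$, the set $\operatorname{conv}(R\cup\{v\})$ is a facet of $Q$ but not of $P$, and it is a pyramid over $R$ with apex $v$ (that is, $v$ is not in the affine span of $R$); - (c) for every ridge $R$ between a facet in $\mathcal N$ and a facet of $P$ outside $\{S\}\cup\mathcal F\cup\mathcal N$, the set $\operatorname{conv}(R\cup\{v\})$ is a facet of $Q$ but not of $P$, and it is a pyramid over $R$ with apex $v$; - (d) for every $F\in\mathcal F$, the set $\operatorname{conv}(F\cup\{v\})$ is a facet of $Q$; it is the pseudo-stacking with new vertex $v$ of $F$, viewed as a polytope in $H_F$, above its simplex facet $S\cap H_F$ with respect to $\emptyset$ and $\mathcal N_F$,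 where $\mathcal N_F$ is the set of those $N\cap F$, $N\in\mathcal N$, that are facets of $F$ (these are facets of $F$ adjacent to $S\cap H_F$). -/

import Mathlib

/-! Convex polytopes, their facets and the pseudo-stacking operation. All notions are relative to the
affine span of the polytope, so that they apply both to a full-dimensional polytope in `ℝ^d` and to
one of its facets `F`, viewed as a polytope in the hyperplane spanned by `F`. -/

namespace PseudoStack

section

variable {E : Type*} [AddCommGroup E] [Module ℝ E] [TopologicalSpace E]

/-- A (convex) polytope: the convex hull of a finite nonempty set of points. -/
def IsPolytope (P : Set E) : Prop :=
  ∃ s : Set E, s.Finite ∧ s.Nonempty ∧ P = convexHull ℝ s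

/-- The dimension of (the affine span of) a nonempty set. -/
noncomputable def pdim (P : Set E) : ℕ :=
  Module.finrank ℝ (vectorSpan ℝ P)

/-- `G` is a nonempty face of `P`: the nonempty set of maximizers over `P` of a continuous linear
functional (the zero functional gives the improper face `P`). -/
def IsFace (P G : Set E) : Prop :=
  IsExposed ℝ P G ∧ G.Nonempty

/-- The set of facets of `P`, the faces of codimension one. -/
def facets (P : Set E) : Set (Set E) :=
  {F | IsFace P F ∧ pdim F + 1 = pdim P}

/-- The set of facets of `P` adjacent to the facet `F`: those that share a ridge, that is, a face of
codimension two, with `F`. The ridge between `F` and `G` is then `F ∩ G`. -/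
def adj (P F : Set E) : Set (Set E) :=
  {G | G ∈ facets P ∧ IsFace P (F ∩ G) ∧ pdim (F ∩ G) + 2 = pdim P}

/-- The inequality `c ≤ f x` is valid for `P`, and `F` is the face of `P` where it is tight. -/
def Supports (P F : Set E) (f : E →L[ℝ] ℝ) (c : ℝ) : Prop :=
  (∀ x ∈ P, c ≤ f x) ∧ F = {x ∈ P | f x = c}

/-- The open half-space `H_F⁺` of the affine span of `P` that is bounded by the hyperplane
`H_F = affineSpan ℝ F` of the facet `F` and whose closure contains `P`: the points beneath `F`. -/
def posSide (P F : Set E) : Set E :=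
  {x | x ∈ affineSpan ℝ P ∧ ∃ (f : E →L[ℝ] ℝ) (c : ℝ), Supports P F f c ∧ c < f x}

/-- The opposite open half-space `H_F⁻`: the points beyond `F`. -/
def negSide (P F : Set E) : Set E :=
  {x | x ∈ affineSpan ℝ P ∧ ∃ (f : E →L[ℝ] ℝ) (c : ℝ), Supports P F f c ∧ f x < c}

/-- Combinatorial equivalence: the face lattices (all faces, including the empty one and the polytope
itself, ordered by inclusion) are isomorphic. -/
def CombEquiv {E' : Type*} [AddCommGroup E'] [Module ℝ E'] [TopologicalSpace E']
    (P : Set E) (P' : Set E') : Prop :=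
  Nonempty ({G : Set E // IsExposed ℝ P G} ≃o {G : Set E' // IsExposed ℝ P' G})

/-- `S` is a simplex facet of the `d`-polytope `P`: a facet combinatorially equivalent to the
`(d-1)`-simplex (which has `d` vertices). -/
def IsSimplexFacet (P S : Set E) : Prop :=
  S ∈ facets P ∧ CombEquiv S (stdSimplex ℝ (Fin (pdim P)))

/-- The facet `F` of the `d`-polytope `P` is in bounded position: any `d` of the hyperplanes spanned by
the facets adjacent to `F` intersect in a single point, and this point lies beyond `F`. -/
def InBoundedPosition (P F : Set E) : Prop :=
  ∀ T : Set (AffineSubspace ℝ E), T ⊆ (fun G : Set E => affineSpan ℝ G) '' adj P F →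
    T.ncard = pdim P → ∃ p ∈ negSide P F, (⋂ H ∈ T, (H : Set E)) = {p}

/-- A set `𝓕` of facets adjacent to the facet `F` of the `d`-polytope `P` is nonsimple: no two adjacent
facets in `𝓕` have a common `(d-3)`-face with `F`. -/
def IsNonsimple (P F : Set E) (𝓕 : Set (Set E)) : Prop :=
  ¬ ∃ G ∈ 𝓕, ∃ G' ∈ 𝓕, G' ∈ adj P G ∧ ∃ K : Set E, IsFace P K ∧ pdim K + 3 = pdim P ∧
    K ⊆ F ∧ K ⊆ G ∧ K ⊆ G'

/-- The region of the points beyond `S` and all facets in `𝓝`, in the hyperplanes of all facets in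
`𝓕`, and beneath all other facets of `P`. -/
def region (P S : Set E) (𝓕 𝓝 : Set (Set E)) : Set E :=
  {v | v ∈ affineSpan ℝ P ∧
    (∀ F ∈ facets P, F ∉ 𝓕 → F ∉ 𝓝 → F ≠ S → v ∈ posSide P F) ∧
    (∀ F ∈ 𝓕, v ∈ affineSpan ℝ F) ∧
    (∀ N ∈ 𝓝, v ∈ negSide P N) ∧ v ∈ negSide P S}

/-- The convex hull of `B` and the point `v`. -/
def hullWith (v : E) (B : Set E) : Set E :=
  convexHull ℝ (insert v B)

/-- `G` is a pyramid with base `R` and apex `v`. -/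
def IsPyramid (G R : Set E) (v : E) : Prop :=
  v ∉ affineSpan ℝ R ∧ G = hullWith v R

/-- `Q` is the pseudo-stacking of `P` above `S` with respect to `𝓕` and `𝓝`, with new vertex `v`. -/
structure IsPseudoStacking (P S : Set E) (𝓕 𝓝 : Set (Set E)) (v : E) (Q : Set E) : Prop where
  isPolytope : IsPolytope P
  isSimplexFacet : IsSimplexFacet P S
  subset_adj_zero : 𝓕 ⊆ adj P S
  subset_adj_neg : 𝓝 ⊆ adj P S
  disjoint : Disjoint 𝓕 𝓝
  mem_region : v ∈ region P S 𝓕 𝓝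
  eq_hull : Q = hullWith v P

end

end PseudoStack

open PseudoStack

/-! Call a facet of `P` visible if `v` lies beyond it. The facets of `conv (P ∪ {v})` are determined by
the position of `v` relative to the facets of `P` alone (`facets_hullWith_cases`): they are the
facets that `v` lies beneath, the hulls of `v` with the facets whose hyperplanes contain `v`, and the
pyramids with apex `v` over the ridges between a visible facet and one that `v` lies beneath. In the
region that defines the pseudo-stacking, the visible facets are `S` and the members of `𝓝`, and the
hyperplanes through `v` are those of the members of `𝓕`, which gives the list of facets.

To see this, take a facet `G` of the hull with its supporting functional `g`. The only case that is not
immediate is that `G` contains `v` and meets `P` in a ridge `R`. The affine functionals vanishing on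
`R` form a plane, in which those that are nonnegative on `P` form the cone spanned by the functionals
of two facets `F₁, F₂` with `R = F₁ ∩ F₂` (`exists_two_facets`). So `g` is a positive combination of the
two, and as it vanishes at `v`, one of them is negative and the other one positive at `v`.

A functional supporting the hull at a relative interior point of a visible facet would be constant on
that facet, but `v` and `P` lie on different sides of the facet; so there is no such functional.

For a facet `F ∈ 𝓕`, the facets of `F` are the ridges `F ∩ G`, and the position of `v` relative to
`F ∩ G` inside the hyperplane of `F` is its position relative to `G`, unless `G ∈ 𝓕` too. This is
excluded by nonsimplicity: a combinatorial simplex is a geometric one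
(`exists_affineIndependent_of_combEquiv`), so two different facets adjacent to `S` always meet `S` in a
common face of codimension three (`isFace_inter_of_adj_simplex`). -/

namespace PseudoStack

/-! ### Faces and supporting inequalities -/

section Hull

variable {E : Type*} [AddCommGroup E] [Module ℝ E]

theorem IsPolytope.convex {P : Set E} (hP : IsPolytope P) : Convex ℝ P := by
  obtain ⟨s, -, -, rfl⟩ := hP
  exact convex_convexHull ℝ s

theorem subset_hullWith (v : E) (P : Set E) : P ⊆ hullWith v P :=
  (Set.subset_insert v P).trans (subset_convexHull ℝ _)

theorem mem_hullWith (v : E) (P : Set E) : v ∈ hullWith v P :=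
  subset_convexHull ℝ _ (Set.mem_insert v P)

variable [TopologicalSpace E]

/-- If `c ≤ f` holds on a set, the tight part of its convex hull is the hull of the tight part. -/
theorem setOf_mem_convexHull_eq {s : Set E} {f : E →L[ℝ] ℝ} {c : ℝ} (h : ∀ x ∈ s, c ≤ f x) :
    {x ∈ convexHull ℝ s | f x = c} = convexHull ℝ {x ∈ s | f x = c} := by
  apply Set.Subset.antisymm
  · have key : convexHull ℝ s ⊆
        {x | c ≤ f x ∧ (f x = c → x ∈ convexHull ℝ {x ∈ s | f x = c})} := by
      refine convexHull_min (fun x hx => ⟨h x hx, fun hc => subset_convexHull ℝ _ ⟨hx, hc⟩⟩) ?_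
      rw [convex_iff_forall_pos]
      rintro x ⟨hx, hx'⟩ y ⟨hy, hy'⟩ a b ha hb hab
      have hb' : b = 1 - a := by linarith
      have e : f (a • x + b • y) - c = a * (f x - c) + b * (f y - c) := by
        simp only [map_add, map_smul, smul_eq_mul]; rw [hb']; ring
      have h1 : 0 ≤ a * (f x - c) := mul_nonneg ha.le (by linarith)
      have h2 : 0 ≤ b * (f y - c) := mul_nonneg hb.le (by linarith)
      refine ⟨by linarith, fun hc => ?_⟩
      have h3 : a * (f x - c) = 0 := by linarith
      have h4 : b * (f y - c) = 0 := by linarith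
      have h5 := (mul_eq_zero.1 h3).resolve_left ha.ne'
      have h6 := (mul_eq_zero.1 h4).resolve_left hb.ne'
      exact convex_convexHull ℝ _ (hx' (by linarith)) (hy' (by linarith)) ha.le hb.le hab
    exact fun x hx => (key hx.1).2 hx.2
  · refine convexHull_min (fun x hx => ⟨subset_convexHull ℝ _ hx.1, hx.2⟩) ?_
    exact (convex_convexHull ℝ s).inter (convex_hyperplane f.toLinearMap.isLinear c)

theorem le_of_mem_convexHull {s : Set E} {f : E →L[ℝ] ℝ} {c : ℝ} (h : ∀ x ∈ s, c ≤ f x) {x : E}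
    (hx : x ∈ convexHull ℝ s) : c ≤ f x :=
  convexHull_min (t := {x | c ≤ f x}) h (convex_halfSpace_ge f.toLinearMap.isLinear c) hx

theorem Supports.subset {P F : Set E} {f : E →L[ℝ] ℝ} {c : ℝ} (h : Supports P F f c) : F ⊆ P := by
  rw [h.2]; exact Set.sep_subset _ _

theorem Supports.eq_of_mem {P F : Set E} {f : E →L[ℝ] ℝ} {c : ℝ} (h : Supports P F f c) {x : E}
    (hx : x ∈ F) : f x = c := by
  rw [h.2] at hx; exact hx.2

theorem Supports.mem {P F : Set E} {f : E →L[ℝ] ℝ} {c : ℝ} (h : Supports P F f c) {x : E}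
    (hx : x ∈ P) (hc : f x = c) : x ∈ F := by
  rw [h.2]; exact ⟨hx, hc⟩

theorem Supports.lt_of_notMem {P F : Set E} {f : E →L[ℝ] ℝ} {c : ℝ} (h : Supports P F f c) {x : E}
    (hx : x ∈ P) (hF : x ∉ F) : c < f x :=
  lt_of_le_of_ne (h.1 x hx) fun e => hF (h.mem hx e.symm)

theorem Supports.convex {P F : Set E} {f : E →L[ℝ] ℝ} {c : ℝ} (h : Supports P F f c)
    (hP : Convex ℝ P) : Convex ℝ F := by
  rw [h.2]; exact hP.inter (convex_hyperplane f.toLinearMap.isLinear c)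

theorem Supports.eq_of_mem_affineSpan {P F : Set E} {f : E →L[ℝ] ℝ} {c : ℝ} (h : Supports P F f c)
    {x : E} (hx : x ∈ affineSpan ℝ F) : f x = c := by
  refine affineSpan_induction (p := fun x => f x = c) hx (fun y hy => h.eq_of_mem hy) ?_
  intro a u v w hu hv hw
  simp [hu, hv, hw]

/-- A supporting inequality of `P` restricts to any subset `F` of `P`. -/
theorem Supports.restrict {P G F : Set E} {f : E →L[ℝ] ℝ} {c : ℝ} (h : Supports P G f c)
    (hF : F ⊆ P) : Supports F (F ∩ G) f c := by
  refine ⟨fun x hx => h.1 x (hF hx), Set.ext fun x => ⟨fun hx => ⟨hx.1, h.eq_of_mem hx.2⟩,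
    fun hx => ⟨hx.1, h.mem (hF hx.1) hx.2⟩⟩⟩

theorem Supports.isExposed [IsTopologicalAddGroup E] {P F : Set E} {f : E →L[ℝ] ℝ} {c : ℝ}
    (h : Supports P F f c) : IsExposed ℝ P F := by
  rintro ⟨z, hz⟩
  refine ⟨-f, Set.ext fun x => ⟨fun hx => ⟨h.subset hx, fun y hy => ?_⟩, fun hx => ?_⟩⟩
  · simpa [h.eq_of_mem hx] using h.1 y hy
  · refine h.mem hx.1 (le_antisymm ?_ (h.1 x hx.1))
    have := hx.2 z (h.subset hz)
    simpa [h.eq_of_mem hz] using this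

theorem Supports.isFace [IsTopologicalAddGroup E] {P F : Set E} {f : E →L[ℝ] ℝ} {c : ℝ}
    (h : Supports P F f c) (hF : F.Nonempty) : IsFace P F :=
  ⟨h.isExposed, hF⟩

theorem IsFace.exists_supports [IsTopologicalAddGroup E] {P F : Set E} (h : IsFace P F) :
    ∃ (f : E →L[ℝ] ℝ) (c : ℝ), Supports P F f c := by
  obtain ⟨l, hl⟩ := h.1 h.2
  obtain ⟨z, hz⟩ := h.2
  have hz' := hz
  rw [hl] at hz'
  refine ⟨-l, -l z, fun x hx => by simpa using hz'.2 x hx, ?_⟩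
  rw [hl]
  ext x
  simp only [Set.mem_ofPred_eq, neg_apply, neg_inj]
  exact ⟨fun hx => ⟨hx.1, le_antisymm (hz'.2 x hx.1) (hx.2 z hz'.1)⟩,
    fun hx => ⟨hx.1, fun y hy => hx.2 ▸ hz'.2 y hy⟩⟩

theorem IsFace.subset {P F : Set E} (h : IsFace P F) : F ⊆ P := h.1.subset

theorem IsFace.isPolytope [IsTopologicalAddGroup E] {P F : Set E} (hP : IsPolytope P)
    (h : IsFace P F) : IsPolytope F := by
  obtain ⟨f, c, hf⟩ := h.exists_supports
  obtain ⟨s, hs, -, rfl⟩ := hP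
  have e : F = convexHull ℝ {x ∈ s | f x = c} := by
    rw [← setOf_mem_convexHull_eq fun x hx => hf.1 x (subset_convexHull ℝ s hx)]; exact hf.2
  refine ⟨_, hs.subset (Set.sep_subset _ _), ?_, e⟩
  have := h.2
  rw [e] at this
  exact convexHull_nonempty_iff.1 this

/-- The face of `conv (P ∪ {v})` cut out by a functional that is larger at `v` than on the face `F`
of `P` is `F` itself. -/
theorem Supports.hullWith_of_lt {P F : Set E} {f : E →L[ℝ] ℝ} {c : ℝ} {v : E}
    (h : Supports P F f c) (hP : Convex ℝ P) (hv : c < f v) : Supports (hullWith v P) F f c := by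
  have hle : ∀ x ∈ insert v P, c ≤ f x := by
    rintro x (rfl | hx)
    exacts [hv.le, h.1 x hx]
  refine ⟨fun x hx => le_of_mem_convexHull hle hx, ?_⟩
  have e : {x ∈ insert v P | f x = c} = F := by
    ext x
    refine ⟨?_, fun hx => ⟨Or.inr (h.subset hx), h.eq_of_mem hx⟩⟩
    rintro ⟨rfl | hx, hc⟩
    exacts [absurd hc hv.ne', h.mem hx hc]
  rw [hullWith, setOf_mem_convexHull_eq hle, e, (h.convex hP).convexHull_eq]

/-- The face of `conv (P ∪ {v})` cut out by a functional that takes the same value at `v` as on the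
face `F` of `P` is `conv (F ∪ {v})`. -/
theorem Supports.hullWith_of_eq {P F : Set E} {f : E →L[ℝ] ℝ} {c : ℝ} {v : E}
    (h : Supports P F f c) (hv : f v = c) :
    Supports (hullWith v P) (hullWith v F) f c := by
  have hle : ∀ x ∈ insert v P, c ≤ f x := by
    rintro x (rfl | hx)
    exacts [hv.ge, h.1 x hx]
  refine ⟨fun x hx => le_of_mem_convexHull hle hx, ?_⟩
  have e : {x ∈ insert v P | f x = c} = insert v F := by
    ext x
    constructor
    · rintro ⟨rfl | hx, hc⟩
      exacts [Or.inl rfl, Or.inr (h.mem hx hc)]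
    · rintro (rfl | hx)
      exacts [⟨Or.inl rfl, hv⟩, ⟨Or.inr (h.subset hx), h.eq_of_mem hx⟩]
  rw [hullWith, hullWith, setOf_mem_convexHull_eq hle, e]

theorem Supports.inter {P F G : Set E} {f g : E →L[ℝ] ℝ} {b c : ℝ} [IsTopologicalAddGroup E]
    [ContinuousConstSMul ℝ E] (hF : Supports P F f b)
    (hG : Supports P G g c) {s t : ℝ} (hs : 0 < s) (ht : 0 < t) :
    Supports P (F ∩ G) (s • f + t • g) (s * b + t * c) := by
  refine ⟨fun x hx => ?_, Set.ext fun x => ⟨fun hx => ⟨hF.subset hx.1, ?_⟩, fun ⟨hx, hc⟩ => ?_⟩⟩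
  · have := mul_le_mul_of_nonneg_left (hF.1 x hx) hs.le
    have := mul_le_mul_of_nonneg_left (hG.1 x hx) ht.le
    simp only [add_apply, smul_apply, smul_eq_mul]
    linarith
  · simp [hF.eq_of_mem hx.1, hG.eq_of_mem hx.2]
  · simp only [add_apply, smul_apply, smul_eq_mul] at hc
    have h1 := mul_le_mul_of_nonneg_left (hF.1 x hx) hs.le
    have h2 := mul_le_mul_of_nonneg_left (hG.1 x hx) ht.le
    exact ⟨hF.mem hx (mul_left_cancel₀ hs.ne' (by linarith)),
      hG.mem hx (mul_left_cancel₀ ht.ne' (by linarith))⟩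

end Hull

/-! ### Faces of faces -/

/-- A face of a face of a polytope is a face of the polytope. -/
theorem IsFace.trans {E : Type*} [NormedAddCommGroup E] [NormedSpace ℝ E] {P F R : Set E}
    (hP : IsPolytope P) (hF : IsFace P F) (hR : IsFace F R) : IsFace P R := by
  obtain ⟨f, c, hf⟩ := hF.exists_supports
  obtain ⟨g, k, hg⟩ := hR.exists_supports
  obtain ⟨s, hs, -, rfl⟩ := hP
  have hsub := subset_convexHull ℝ s
  -- A large multiple of `f` outweighs `g` at the finitely many points of `s` outside `F`.
  obtain ⟨M, hM⟩ : ∃ M : ℝ, ∀ y ∈ s, y ∉ F → k - g y < M * (f y - c) := by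
    obtain ⟨M, hM⟩ := (hs.image fun y => (k - g y) / (f y - c)).bddAbove
    refine ⟨M + 1, fun y hy hyF => ?_⟩
    have hpos : 0 < f y - c := sub_pos.2 (hf.lt_of_notMem (hsub hy) hyF)
    have h1 : (k - g y) / (f y - c) ≤ M := hM ⟨y, hy, rfl⟩
    rw [← div_lt_iff₀ hpos]; linarith
  have hval : ∀ y, (M • f + g) y - (M * c + k) = M * (f y - c) + (g y - k) := fun y => by
    simp only [add_apply, smul_apply, smul_eq_mul]; ring
  have hle : ∀ y ∈ s, M * c + k ≤ (M • f + g) y := fun y hy => by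
    by_cases hyF : y ∈ F
    · have := hval y; rw [hf.eq_of_mem hyF] at this; have := hg.1 y hyF; linarith
    · have := hval y; have := hM y hy hyF; linarith
  have hR' : Supports (convexHull ℝ s) R (M • f + g) (M * c + k) := by
    refine ⟨fun x hx => le_of_mem_convexHull hle hx, ?_⟩
    apply Set.Subset.antisymm
    · intro x hx
      refine ⟨hf.subset (hg.subset hx), ?_⟩
      simp [hf.eq_of_mem (hg.subset hx), hg.eq_of_mem hx]
    · rw [setOf_mem_convexHull_eq hle]
      refine convexHull_min ?_ (hg.convex (hf.convex (convex_convexHull ℝ s)))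
      rintro y ⟨hy, hc⟩
      have h1 := hval y
      have hyF : y ∈ F := by
        by_contra hyF
        have := hM y hy hyF
        linarith
      rw [hf.eq_of_mem hyF] at h1
      exact hg.mem hyF (by linarith)
  exact hR'.isFace hR.2

/-! ### Dimension -/

section Dim

variable {E : Type*} [NormedAddCommGroup E] [NormedSpace ℝ E]

theorem vectorSpan_le_ker {A : Set E} {f : E →L[ℝ] ℝ} {c : ℝ} (h : ∀ x ∈ A, f x = c) :
    vectorSpan ℝ A ≤ LinearMap.ker f.toLinearMap := by
  rw [vectorSpan_def, Submodule.span_le]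
  rintro _ ⟨x, hx, y, hy, rfl⟩
  simp [h x hx, h y hy]

theorem vectorSpan_hullWith (v : E) (R : Set E) :
    vectorSpan ℝ (hullWith v R) = vectorSpan ℝ (insert v R) := by
  rw [hullWith, ← direction_affineSpan, affineSpan_convexHull, direction_affineSpan]

theorem pdim_hullWith_of_mem {v : E} {R : Set E} (hv : v ∈ affineSpan ℝ R) :
    pdim (hullWith v R) = pdim R := by
  rw [pdim, vectorSpan_hullWith, vectorSpan_insert_eq_vectorSpan hv, pdim]

theorem pdim_hullWith_le (v : E) (R : Set E) : pdim (hullWith v R) ≤ pdim R + 1 := by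
  rw [pdim, vectorSpan_hullWith]
  exact finrank_vectorSpan_insert_le_set ℝ R v

variable [FiniteDimensional ℝ E]

theorem pdim_mono {A B : Set E} (h : A ⊆ B) : pdim A ≤ pdim B :=
  Submodule.finrank_mono (vectorSpan_mono ℝ h)

theorem vectorSpan_eq_top {P : Set E} (hP : pdim P = Module.finrank ℝ E) :
    vectorSpan ℝ P = ⊤ :=
  Submodule.eq_top_of_finrank_eq hP

theorem affineSpan_eq_top {P : Set E} (hP : pdim P = Module.finrank ℝ E) (hne : P.Nonempty) :
    affineSpan ℝ P = ⊤ :=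
  (AffineSubspace.affineSpan_eq_top_iff_vectorSpan_eq_top_of_nonempty ℝ E E hne).2
    (vectorSpan_eq_top hP)

theorem eq_zero_of_forall_eq {P : Set E} (hP : pdim P = Module.finrank ℝ E) {f : E →L[ℝ] ℝ} {c : ℝ}
    (h : ∀ x ∈ P, f x = c) : f = 0 := by
  have := vectorSpan_le_ker h
  rw [vectorSpan_eq_top hP] at this
  ext x
  exact this trivial

theorem finrank_ker_add_one {f : E →L[ℝ] ℝ} (hf : f ≠ 0) :
    Module.finrank ℝ (LinearMap.ker f.toLinearMap) + 1 = Module.finrank ℝ E := by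
  have h0 : f.toLinearMap ≠ 0 := fun h => hf (by ext x; exact LinearMap.congr_fun h x)
  have := Module.Dual.finrank_ker_add_one_of_ne_zero (f := f.toLinearMap) h0
  exact this

theorem pdim_add_one_le {A : Set E} {f : E →L[ℝ] ℝ} {c : ℝ} (hf : f ≠ 0)
    (h : ∀ x ∈ A, f x = c) : pdim A + 1 ≤ Module.finrank ℝ E := by
  rw [← finrank_ker_add_one hf]
  exact Nat.add_le_add_right (Submodule.finrank_mono (vectorSpan_le_ker h)) 1

theorem pdim_lt_pdim {R A : Set E} (hRA : R ⊆ A) (hR : R.Nonempty) {f : E →L[ℝ] ℝ} {c : ℝ}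
    (h : ∀ x ∈ R, f x = c) {y : E} (hy : y ∈ A) (hyc : f y ≠ c) : pdim R < pdim A := by
  refine Submodule.finrank_lt_finrank_of_lt (lt_of_le_of_ne (vectorSpan_mono ℝ hRA) fun e => ?_)
  obtain ⟨r, hr⟩ := hR
  have h1 : y -ᵥ r ∈ vectorSpan ℝ R := e ▸ vsub_mem_vectorSpan ℝ hy (hRA hr)
  have h2 := vectorSpan_le_ker h h1
  simp only [vsub_eq_sub, LinearMap.mem_ker, ContinuousLinearMap.coe_coe, map_sub, h r hr] at h2
  exact hyc (sub_eq_zero.1 h2)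

theorem pdim_hullWith_eq {P : Set E} (hP : pdim P = Module.finrank ℝ E) (v : E) :
    pdim (hullWith v P) = Module.finrank ℝ E :=
  le_antisymm (Submodule.finrank_le _) (hP ▸ pdim_mono (subset_hullWith v P))

/-! ### Facets and their hyperplanes -/

theorem Supports.exists_lt {P F : Set E} {h : E →L[ℝ] ℝ} {c : ℝ} (hF : pdim F < pdim P)
    (hs : Supports P F h c) : ∃ p ∈ P, c < h p := by
  by_contra! hcon
  have : P ⊆ F := fun p hp => hs.mem hp (le_antisymm (hcon p hp) (hs.1 p hp))
  exact absurd (pdim_mono this) (not_le.2 hF)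

theorem ne_zero_of_facet {P F : Set E} (hF : F ∈ facets P)
    {h : E →L[ℝ] ℝ} {c : ℝ} (hs : Supports P F h c) : h ≠ 0 := by
  rintro rfl
  obtain ⟨x, hx⟩ := hF.1.2
  obtain ⟨p, hp, hlt⟩ := hs.exists_lt (by have := hF.2; omega)
  have := hs.eq_of_mem hx
  simp at this hlt
  linarith

theorem vectorSpan_facet {P F : Set E} (hP : pdim P = Module.finrank ℝ E) (hF : F ∈ facets P)
    {h : E →L[ℝ] ℝ} {c : ℝ} (hs : Supports P F h c) :
    vectorSpan ℝ F = LinearMap.ker h.toLinearMap := by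
  refine Submodule.eq_of_le_of_finrank_eq (vectorSpan_le_ker fun x hx => hs.eq_of_mem hx) ?_
  have h1 := finrank_ker_add_one (ne_zero_of_facet hF hs)
  have h2 := hF.2
  rw [pdim] at h2
  omega

/-- A functional that is constant on a facet is a multiple of the functional defining the facet. -/
theorem exists_eq_smul_of_facet {P F : Set E} (hP : pdim P = Module.finrank ℝ E)
    (hF : F ∈ facets P) {h g : E →L[ℝ] ℝ} {c k : ℝ} (hs : Supports P F h c)
    (hg : ∀ x ∈ F, g x = k) : ∃ t : ℝ, g = t • h ∧ k = t * c := by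
  have h1 : (⨅ _ : Unit, LinearMap.ker h.toLinearMap) ≤ LinearMap.ker g.toLinearMap := by
    rw [ciInf_const, ← vectorSpan_facet hP hF hs]
    exact vectorSpan_le_ker hg
  have h2 := mem_span_of_iInf_ker_le_ker (L := fun _ : Unit => h.toLinearMap) h1
  rw [Set.range_const, Submodule.mem_span_singleton] at h2
  obtain ⟨t, ht⟩ := h2
  have ht' : g = t • h := by
    ext x
    exact (LinearMap.congr_fun ht x).symm
  refine ⟨t, ht', ?_⟩
  obtain ⟨x, hx⟩ := hF.1.2
  rw [← hg x hx, ht', ← hs.eq_of_mem hx]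
  rfl

/-- The supporting inequality of a facet is unique up to a positive factor. -/
theorem Supports.unique {P F : Set E} (hP : pdim P = Module.finrank ℝ E)
    (hF : F ∈ facets P) {h g : E →L[ℝ] ℝ} {c k : ℝ} (hs : Supports P F h c)
    (hg : Supports P F g k) : ∃ t : ℝ, 0 < t ∧ ∀ x, g x - k = t * (h x - c) := by
  obtain ⟨t, rfl, rfl⟩ := exists_eq_smul_of_facet hP hF hs fun x hx => hg.eq_of_mem hx
  have hlt : pdim F < pdim P := by have := hF.2; omega
  obtain ⟨p, hp, h1⟩ := hs.exists_lt hlt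
  refine ⟨t, ?_, fun x => by simp; ring⟩
  have h2 : p ∉ F := fun hpF => h1.ne' (hs.eq_of_mem hpF)
  have h3 := hg.lt_of_notMem hp h2
  simp only [smul_apply, smul_eq_mul] at h3
  have : 0 < t * (h p - c) := by linarith
  exact pos_of_mul_pos_left this (by linarith)

theorem mem_affineSpan_facet_iff {P F : Set E} (hP : pdim P = Module.finrank ℝ E)
    (hF : F ∈ facets P) {h : E →L[ℝ] ℝ} {c : ℝ} (hs : Supports P F h c) (x : E) :
    x ∈ affineSpan ℝ F ↔ h x = c := by
  refine ⟨fun hx => hs.eq_of_mem_affineSpan hx, fun hx => ?_⟩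
  obtain ⟨y, hy⟩ := hF.1.2
  have hy' := subset_affineSpan ℝ F hy
  rw [← AffineSubspace.vsub_right_mem_direction_iff_mem hy', direction_affineSpan,
    vectorSpan_facet hP hF hs]
  simp [hx, hs.eq_of_mem hy]

theorem mem_posSide_iff {P F : Set E} (hP : pdim P = Module.finrank ℝ E)
    (hF : F ∈ facets P) {h : E →L[ℝ] ℝ} {c : ℝ} (hs : Supports P F h c) (x : E) :
    x ∈ posSide P F ↔ c < h x := by
  constructor
  · rintro ⟨-, g, k, hg, hlt⟩
    obtain ⟨t, ht, e⟩ := hs.unique hP hF hg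
    have : 0 < t * (h x - c) := by rw [← e]; linarith
    linarith [pos_of_mul_pos_right this ht.le]
  · intro hx
    rw [posSide, affineSpan_eq_top hP (hF.1.2.mono hF.1.subset)]
    exact ⟨trivial, h, c, hs, hx⟩

theorem mem_negSide_iff {P F : Set E} (hP : pdim P = Module.finrank ℝ E)
    (hF : F ∈ facets P) {h : E →L[ℝ] ℝ} {c : ℝ} (hs : Supports P F h c) (x : E) :
    x ∈ negSide P F ↔ h x < c := by
  constructor
  · rintro ⟨-, g, k, hg, hlt⟩
    obtain ⟨t, ht, e⟩ := hs.unique hP hF hg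
    by_contra! hcon
    have : 0 ≤ t * (h x - c) := mul_nonneg ht.le (by linarith)
    rw [← e] at this
    linarith
  · intro hx
    rw [negSide, affineSpan_eq_top hP (hF.1.2.mono hF.1.subset)]
    exact ⟨trivial, h, c, hs, hx⟩

/-- A facet contained in another facet equals it. -/
theorem facet_eq_of_subset {P F G : Set E}
    (hF : F ∈ facets P) (hG : G ∈ facets P) (h : F ⊆ G) : F = G := by
  refine h.antisymm fun x hx => ?_
  by_contra hxF
  obtain ⟨f, c, hs⟩ := hF.1.exists_supports
  have := pdim_lt_pdim h hF.1.2 (fun y hy => hs.eq_of_mem hy) hx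
    (hs.lt_of_notMem (hG.1.subset hx) hxF).ne'
  have := hF.2
  have := hG.2
  omega

end Dim

section Ridge

variable {E : Type*} [NormedAddCommGroup E] [NormedSpace ℝ E] [FiniteDimensional ℝ E]

/-! ### The two facets at a ridge -/

/-- The functionals vanishing on a subspace of codimension two form a plane: a functional `g ≠ 0` of
this kind is completed by some `g'` to a basis. -/
theorem exists_functional_basis {W : Submodule ℝ E}
    (hW : Module.finrank ℝ W + 2 = Module.finrank ℝ E) {g : E →L[ℝ] ℝ} (hg : g ≠ 0)
    (hWg : W ≤ LinearMap.ker g.toLinearMap) :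
    ∃ (g' : E →L[ℝ] ℝ) (u : E), W ≤ LinearMap.ker g'.toLinearMap ∧ g u = 0 ∧ g' u ≠ 0 ∧
      ∀ h : E →L[ℝ] ℝ, W ≤ LinearMap.ker h.toLinearMap → ∃ a b : ℝ, h = a • g + b • g' := by
  have hker := finrank_ker_add_one hg
  obtain ⟨u, hu, huW⟩ : ∃ u ∈ LinearMap.ker g.toLinearMap, u ∉ W := by
    by_contra! hcon
    have := Submodule.finrank_mono (R := ℝ) (fun x hx => hcon x hx :
      LinearMap.ker g.toLinearMap ≤ W)
    omega
  obtain ⟨g', hg'u, hg'W⟩ := Submodule.exists_le_ker_of_notMem huW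
  have hW' : W = LinearMap.ker g.toLinearMap ⊓ LinearMap.ker g' := by
    refine Submodule.eq_of_le_of_finrank_le (le_inf hWg hg'W) ?_
    have : LinearMap.ker g.toLinearMap ⊓ LinearMap.ker g' < LinearMap.ker g.toLinearMap :=
      lt_of_le_of_ne inf_le_left fun e => hg'u (inf_eq_left.1 e hu)
    have := Submodule.finrank_lt_finrank_of_lt this
    omega
  refine ⟨g'.toContinuousLinearMap, u, hg'W, hu, hg'u, fun h hh => ?_⟩
  have h1 : (⨅ i, LinearMap.ker ((![g.toLinearMap, g'] : Fin 2 → E →ₗ[ℝ] ℝ) i)) ≤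
      LinearMap.ker h.toLinearMap := by
    refine le_trans ?_ hh
    rw [hW']
    exact le_inf (iInf_le_of_le 0 le_rfl) (iInf_le_of_le 1 le_rfl)
  obtain ⟨c, hc⟩ := (Submodule.mem_span_range_iff_exists_fun ℝ).1 (mem_span_of_iInf_ker_le_ker h1)
  refine ⟨c 0, c 1, ?_⟩
  ext x
  have := LinearMap.congr_fun hc x
  simpa [Fin.sum_univ_two] using this.symm

/-- A ridge `R` of a full-dimensional polytope `P` is the intersection of two facets of `P`, and every
affine inequality valid for `P` and tight on `R` is a nonnegative combination of the inequalities of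
these two facets. The facets are found by rotating a supporting hyperplane about `R` in both
directions until it meets a further vertex. -/
theorem exists_two_facets {P R : Set E} (hP : IsPolytope P) (hd : pdim P = Module.finrank ℝ E)
    (hR : IsFace P R) (hRd : pdim R + 2 = Module.finrank ℝ E) :
    ∃ (F₁ F₂ : Set E) (f₁ f₂ : E →L[ℝ] ℝ) (c₁ c₂ : ℝ), F₁ ∈ facets P ∧ F₂ ∈ facets P ∧
      Supports P F₁ f₁ c₁ ∧ Supports P F₂ f₂ c₂ ∧ R = F₁ ∩ F₂ ∧
      ∀ (h : E →L[ℝ] ℝ) (k : ℝ), (∀ x ∈ P, k ≤ h x) → (∀ x ∈ R, h x = k) →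
        ∃ a b : ℝ, 0 ≤ a ∧ 0 ≤ b ∧ h = a • f₁ + b • f₂ ∧ k = a * c₁ + b * c₂ := by
  obtain ⟨g, c, hg⟩ := hR.exists_supports
  obtain ⟨r, hr⟩ := hR.2
  obtain ⟨p, hp, hpc⟩ := hg.exists_lt (by omega)
  have hrc := hg.eq_of_mem hr
  have hg0 : g ≠ 0 := by
    rintro rfl
    simp at hpc hrc
    linarith
  obtain ⟨g', u, hWg', hgu, hg'u, hbasis⟩ := exists_functional_basis (W := vectorSpan ℝ R) hRd hg0
    (vectorSpan_le_ker fun x hx => hg.eq_of_mem hx)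
  have hker : ∀ h : E →L[ℝ] ℝ, vectorSpan ℝ R ≤ LinearMap.ker h.toLinearMap →
      ∀ x ∈ R, h x = h r := fun h hh x hx => by
    have := hh (vsub_mem_vectorSpan ℝ hx hr)
    simpa [sub_eq_zero] using this
  obtain ⟨s, hs, -, rfl⟩ := hP
  have hsub := subset_convexHull ℝ s
  have hne : {y ∈ s | c < g y}.Nonempty := by
    by_contra hcon
    have h1 : ∀ y ∈ s, -c ≤ (-g) y := fun y hy => by
      have : ¬ c < g y := fun h => hcon ⟨y, hy, h⟩
      simp only [neg_apply]; linarith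
    have := le_of_mem_convexHull h1 hp
    simp only [neg_apply] at this
    linarith
  have hfin : {y ∈ s | c < g y}.Finite := hs.subset (Set.sep_subset _ _)
  -- Seen along `R`, the polytope is an angle in the plane with coordinates `g` and `g'`; the facets
  -- at `R` are spanned by `R` and points of extreme slope.
  obtain ⟨y₁, ⟨hy₁s, hy₁c⟩, hmax⟩ :=
    hfin.exists_maximalFor (fun y => (g' y - g' r) / (g y - c)) _ hne
  obtain ⟨y₂, ⟨hy₂s, hy₂c⟩, hmin⟩ :=
    hfin.exists_minimalFor (fun y => (g' y - g' r) / (g y - c)) _ hne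
  set b := (g' y₁ - g' r) / (g y₁ - c) with hb
  set a := (g' y₂ - g' r) / (g y₂ - c) with ha
  have hle_b : ∀ y ∈ s, g' y - g' r ≤ b * (g y - c) := fun y hy => by
    rcases (hg.1 y (hsub hy)).eq_or_lt with h | h
    · rw [hker g' hWg' y (hg.mem (hsub hy) h.symm), ← h]; simp
    · rw [← div_le_iff₀ (by linarith)]
      by_contra! hcon
      exact absurd (hmax ⟨hy, h⟩ hcon.le) (not_le.2 hcon)
  have hle_a : ∀ y ∈ s, a * (g y - c) ≤ g' y - g' r := fun y hy => by
    rcases (hg.1 y (hsub hy)).eq_or_lt with h | h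
    · rw [hker g' hWg' y (hg.mem (hsub hy) h.symm), ← h]; simp
    · rw [← le_div_iff₀ (by linarith)]
      by_contra! hcon
      exact absurd (hmin ⟨hy, h⟩ hcon.le) (not_le.2 hcon)
  have hy₁ : g' y₁ - g' r = b * (g y₁ - c) := by rw [hb]; field_simp [(sub_pos.2 hy₁c).ne']
  have hy₂ : g' y₂ - g' r = a * (g y₂ - c) := by rw [ha]; field_simp [(sub_pos.2 hy₂c).ne']
  obtain ⟨f₁, hf₁⟩ : ∃ f : E →L[ℝ] ℝ, f = b • g - g' := ⟨_, rfl⟩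
  obtain ⟨f₂, hf₂⟩ : ∃ f : E →L[ℝ] ℝ, f = g' - a • g := ⟨_, rfl⟩
  have hv₁ : ∀ x, f₁ x = b * g x - g' x := fun x => by simp [hf₁]
  have hv₂ : ∀ x, f₂ x = g' x - a * g x := fun x => by simp [hf₂]
  have hf₁0 : f₁ ≠ 0 := fun h => hg'u (by have := hv₁ u; rw [h, hgu] at this; simpa using this)
  have hf₂0 : f₂ ≠ 0 := fun h => hg'u (by have := hv₂ u; rw [h, hgu] at this; simpa using this.symm)
  have hval₁ : ∀ x ∈ convexHull ℝ s, b * c - g' r ≤ f₁ x := fun x hx =>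
    le_of_mem_convexHull (fun y hy => by have := hle_b y hy; rw [hv₁]; linarith) hx
  have hval₂ : ∀ x ∈ convexHull ℝ s, g' r - a * c ≤ f₂ x := fun x hx =>
    le_of_mem_convexHull (fun y hy => by have := hle_a y hy; rw [hv₂]; linarith) hx
  have hab : a < b := by
    by_contra! hcon
    refine hf₁0 (eq_zero_of_forall_eq hd (c := b * c - g' r) fun x hx => le_antisymm ?_ (hval₁ x hx))
    have h1 := hval₂ x hx
    rw [hv₂] at h1
    rw [hv₁]
    have := mul_nonneg (sub_nonneg.2 hcon) (sub_nonneg.2 (hg.1 x hx))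
    linarith
  have hs₁ : Supports (convexHull ℝ s) {x ∈ convexHull ℝ s | f₁ x = b * c - g' r} f₁
    (b * c - g' r) := ⟨hval₁, rfl⟩
  have hs₂ : Supports (convexHull ℝ s) {x ∈ convexHull ℝ s | f₂ x = g' r - a * c} f₂
    (g' r - a * c) := ⟨hval₂, rfl⟩
  have hR₁ : R ⊆ {x ∈ convexHull ℝ s | f₁ x = b * c - g' r} := fun x hx =>
    ⟨hg.subset hx, by rw [hv₁, hg.eq_of_mem hx, hker g' hWg' x hx]⟩
  have hR₂ : R ⊆ {x ∈ convexHull ℝ s | f₂ x = g' r - a * c} := fun x hx =>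
    ⟨hg.subset hx, by rw [hv₂, hg.eq_of_mem hx, hker g' hWg' x hx]⟩
  have hm₁ : y₁ ∈ {x ∈ convexHull ℝ s | f₁ x = b * c - g' r} :=
    ⟨hsub hy₁s, by rw [hv₁]; linarith⟩
  have hm₂ : y₂ ∈ {x ∈ convexHull ℝ s | f₂ x = g' r - a * c} :=
    ⟨hsub hy₂s, by rw [hv₂]; linarith⟩
  refine ⟨_, _, f₁, f₂, _, _, ⟨hs₁.isFace ⟨y₁, hm₁⟩, ?_⟩, ⟨hs₂.isFace ⟨y₂, hm₂⟩, ?_⟩, hs₁, hs₂,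
    Set.Subset.antisymm (Set.subset_inter hR₁ hR₂) ?_, ?_⟩
  · have h1 := pdim_lt_pdim hR₁ ⟨r, hr⟩ (fun x hx => hg.eq_of_mem hx) hm₁ hy₁c.ne'
    have h2 := pdim_add_one_le hf₁0 fun x hx => hs₁.eq_of_mem hx
    omega
  · have h1 := pdim_lt_pdim hR₂ ⟨r, hr⟩ (fun x hx => hg.eq_of_mem hx) hm₂ hy₂c.ne'
    have h2 := pdim_add_one_le hf₂0 fun x hx => hs₂.eq_of_mem hx
    omega
  · rintro x ⟨⟨hx, h1⟩, -, h2⟩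
    rw [hv₁] at h1
    rw [hv₂] at h2
    refine hg.mem hx (mul_left_cancel₀ (sub_pos.2 hab).ne' ?_)
    linarith
  · intro h k hk hRk
    obtain ⟨α, β, hαβ⟩ := hbasis h (vectorSpan_le_ker hRk)
    -- Rewrite `h` in the basis `f₁, f₂`: `(b - a) g = f₁ + f₂` and `(b - a) g' = a f₁ + b f₂`.
    have hba := (sub_pos.2 hab).ne'
    have e : h = ((α + β * a) / (b - a)) • f₁ + ((α + β * b) / (b - a)) • f₂ := by
      ext x
      rw [hαβ]
      simp only [add_apply, smul_apply, smul_eq_mul, hv₁, hv₂]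
      field_simp
      ring
    generalize (α + β * a) / (b - a) = A at e
    generalize (α + β * b) / (b - a) = B at e
    have ek : k = A * (b * c - g' r) + B * (g' r - a * c) := by
      rw [← hRk r hr, e, ← (hR₁ hr).2, ← (hR₂ hr).2]; simp
    have n₁ : 0 ≤ B * ((b - a) * (g y₁ - c)) := by
      have := hk y₁ (hsub hy₁s)
      rw [e, ek] at this
      simp only [add_apply, smul_apply, smul_eq_mul] at this
      rw [hm₁.2, hv₂] at this
      have h3 : g' y₁ = g' r + b * (g y₁ - c) := by linarith
      rw [h3] at this
      linarith
    have n₂ : 0 ≤ A * ((b - a) * (g y₂ - c)) := by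
      have := hk y₂ (hsub hy₂s)
      rw [e, ek] at this
      simp only [add_apply, smul_apply, smul_eq_mul] at this
      rw [hm₂.2, hv₁] at this
      have h3 : g' y₂ = g' r + a * (g y₂ - c) := by linarith
      rw [h3] at this
      linarith
    exact ⟨A, B,
      nonneg_of_mul_nonneg_left n₂ (mul_pos (sub_pos.2 hab) (sub_pos.2 hy₂c)),
      nonneg_of_mul_nonneg_left n₁ (mul_pos (sub_pos.2 hab) (sub_pos.2 hy₁c)), e, ek⟩

/-- A ridge lies in exactly two facets, and is their intersection. -/
theorem exists_two_facets_iff {P R : Set E} (hP : IsPolytope P)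
    (hd : pdim P = Module.finrank ℝ E) (hR : IsFace P R) (hRd : pdim R + 2 = Module.finrank ℝ E) :
    ∃ F₁ F₂ : Set E, F₁ ≠ F₂ ∧ R = F₁ ∩ F₂ ∧ ∀ F, F ∈ facets P ∧ R ⊆ F ↔ F = F₁ ∨ F = F₂ := by
  obtain ⟨F₁, F₂, f₁, f₂, c₁, c₂, hF₁, hF₂, hs₁, hs₂, rfl, hcone⟩ := exists_two_facets hP hd hR hRd
  have hne : F₁ ≠ F₂ := by
    rintro rfl
    rw [Set.inter_self] at hRd
    have := hF₁.2
    omega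
  refine ⟨F₁, F₂, hne, rfl, fun F => ⟨?_, ?_⟩⟩
  · rintro ⟨hF, hRF⟩
    obtain ⟨f, c, hs⟩ := hF.1.exists_supports
    obtain ⟨a, b, ha, hb, e, ec⟩ := hcone f c hs.1 fun x hx => hs.eq_of_mem (hRF hx)
    rcases hb.eq_or_lt with rfl | hb
    · left
      refine (facet_eq_of_subset hF₁ hF fun x hx => hs.mem (hF₁.1.subset hx) ?_).symm
      rw [e, ec, ← hs₁.eq_of_mem hx]; simp
    rcases ha.eq_or_lt with rfl | ha
    · right
      refine (facet_eq_of_subset hF₂ hF fun x hx => hs.mem (hF₂.1.subset hx) ?_).symm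
      rw [e, ec, ← hs₂.eq_of_mem hx]; simp
    · have h1 := hs₁.inter hs₂ ha hb
      rw [← e, ← ec] at h1
      have h2 : F = F₁ ∩ F₂ := hs.2.trans h1.2.symm
      rw [← h2] at hRd
      have := hF.2
      omega
  · rintro (rfl | rfl)
    exacts [⟨hF₁, Set.inter_subset_left⟩, ⟨hF₂, Set.inter_subset_right⟩]

end Ridge

/-! ### Simplices -/

section Simplex

variable {E : Type*} [NormedAddCommGroup E] [NormedSpace ℝ E]

/-- A functional taking prescribed values, up to a common constant, at affinely independent points. -/
theorem exists_functional_of_affineIndependent [FiniteDimensional ℝ E] {ι : Type*} {p : ι → E}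
    (hp : AffineIndependent ℝ p) (i₀ : ι) (w : ι → ℝ) :
    ∃ f : E →L[ℝ] ℝ, ∀ i, f (p i) = w i - w i₀ + f (p i₀) := by
  rw [affineIndependent_iff_linearIndependent_vsub ℝ p i₀] at hp
  obtain ⟨g, hg⟩ := LinearMap.exists_leftInverse_of_injective _
    (LinearMap.ker_eq_bot.2 (linearIndependent_iff_injective_finsuppLinearCombination.1 hp))
  let f : E →ₗ[ℝ] ℝ :=
    (Finsupp.linearCombination ℝ fun i : {x // x ≠ i₀} => w i - w i₀).comp g
  refine ⟨f.toContinuousLinearMap, fun i => ?_⟩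
  by_cases hi : i = i₀
  · subst hi; simp
  · have h1 : g (p i -ᵥ p i₀) = Finsupp.single ⟨i, hi⟩ 1 := by
      have := LinearMap.congr_fun hg (Finsupp.single ⟨i, hi⟩ 1)
      simpa using this
    have h2 : f (p i -ᵥ p i₀) = w i - w i₀ := by
      rw [LinearMap.comp_apply, h1]
      simp
    rw [vsub_eq_sub, map_sub] at h2
    simp only [LinearMap.coe_toContinuousLinearMap']
    linarith

/-- The hull of any subset of the vertices of a simplex is a face. -/
theorem isExposed_convexHull_image [FiniteDimensional ℝ E] {ι : Type*} {p : ι → E}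
    (hp : AffineIndependent ℝ p) (A : Set ι) :
    IsExposed ℝ (convexHull ℝ (Set.range p)) (convexHull ℝ (p '' A)) := by
  classical
  rcases A.eq_empty_or_nonempty with rfl | ⟨i₀, hi₀⟩
  · simpa using isExposed_empty
  obtain ⟨f, hf⟩ := exists_functional_of_affineIndependent hp i₀ fun i => if i ∈ A then 0 else 1
  simp only [if_pos hi₀, sub_zero] at hf
  have hle : ∀ x ∈ Set.range p, f (p i₀) ≤ f x := by
    rintro _ ⟨i, rfl⟩
    rw [hf i]
    split_ifs <;> linarith
  have e : {x ∈ Set.range p | f x = f (p i₀)} = p '' A := by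
    ext x
    constructor
    · rintro ⟨⟨i, rfl⟩, hi⟩
      rw [hf i] at hi
      refine ⟨i, ?_, rfl⟩
      by_contra hA
      rw [if_neg hA] at hi
      linarith
    · rintro ⟨i, hi, rfl⟩
      exact ⟨⟨i, rfl⟩, by rw [hf i, if_pos hi, zero_add]⟩
  refine Supports.isExposed (f := f) (c := f (p i₀)) ⟨fun x hx => le_of_mem_convexHull hle hx, ?_⟩
  rw [setOf_mem_convexHull_eq hle, e]

theorem mem_convexHull_image_iff {ι : Type*} {p : ι → E}
    (hp : AffineIndependent ℝ p) (A : Set ι) (i : ι) : p i ∈ convexHull ℝ (p '' A) ↔ i ∈ A :=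
  ⟨fun h => (hp.mem_affineSpan_iff i A).1 (convexHull_subset_affineSpan _ h),
    fun h => subset_convexHull ℝ _ ⟨i, h, rfl⟩⟩

theorem eq_convexHull_image_of_isExposed {ι : Type*} {p : ι → E} {G : Set E}
    (hG : IsExposed ℝ (convexHull ℝ (Set.range p)) G) : G = convexHull ℝ (p '' {i | p i ∈ G}) := by
  rcases G.eq_empty_or_nonempty with rfl | hne
  · simp
  obtain ⟨f, c, hs⟩ := IsFace.exists_supports ⟨hG, hne⟩
  have hsub := subset_convexHull ℝ (Set.range p)
  have h1 := setOf_mem_convexHull_eq fun x hx => hs.1 x (hsub hx)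
  rw [← hs.2] at h1
  have e : {x ∈ Set.range p | f x = c} = p '' {i | p i ∈ G} := by
    ext x
    constructor
    · rintro ⟨⟨i, rfl⟩, hi⟩
      exact ⟨i, hs.mem (hsub ⟨i, rfl⟩) hi, rfl⟩
    · rintro ⟨i, hi, rfl⟩
      exact ⟨⟨i, rfl⟩, hs.eq_of_mem hi⟩
  rw [← e, ← h1]

/-- The face lattice of the simplex spanned by affinely independent points is the lattice of all sets
of vertices. -/
noncomputable def simplexFaceIso [FiniteDimensional ℝ E] {ι : Type*} {p : ι → E}
    (hp : AffineIndependent ℝ p) :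
    {G : Set E // IsExposed ℝ (convexHull ℝ (Set.range p)) G} ≃o Set ι where
  toFun G := {i | p i ∈ G.1}
  invFun A := ⟨convexHull ℝ (p '' A), isExposed_convexHull_image hp A⟩
  left_inv G := Subtype.ext (eq_convexHull_image_of_isExposed G.2).symm
  right_inv A := Set.ext fun i => mem_convexHull_image_iff hp A i
  map_rel_iff' {G G'} := by
    refine ⟨fun h => ?_, fun h i hi => h hi⟩
    change G.1 ⊆ G'.1
    rw [eq_convexHull_image_of_isExposed G.2, eq_convexHull_image_of_isExposed G'.2]
    exact convexHull_mono (Set.image_mono h)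

theorem nonempty_stdSimplex_faceIso (n : ℕ) :
    Nonempty ({G : Set (Fin n → ℝ) // IsExposed ℝ (stdSimplex ℝ (Fin n)) G} ≃o Set (Fin n)) := by
  have h : AffineIndependent ℝ (fun i : Fin n => (Pi.single i 1 : Fin n → ℝ)) := by
    convert! (Pi.basisFun ℝ (Fin n)).linearIndependent.affineIndependent
    simp
  rw [← convexHull_rangle_single_eq_stdSimplex]
  exact ⟨simplexFaceIso h⟩

theorem combEquiv_stdSimplex [FiniteDimensional ℝ E] {n : ℕ} {p : Fin n → E}
    (hp : AffineIndependent ℝ p) :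
    CombEquiv (convexHull ℝ (Set.range p)) (stdSimplex ℝ (Fin n)) :=
  (nonempty_stdSimplex_faceIso n).map fun φ => (simplexFaceIso hp).trans φ.symm

/-- A polytope is the hull of its finitely many extreme points, and each of them is a face. -/
theorem IsPolytope.exists_vertices {P : Set E} (hP : IsPolytope P) :
    ∃ t : Set E, t.Finite ∧ P = convexHull ℝ t ∧ ∀ x ∈ t, IsFace P {x} := by
  obtain ⟨s, hs, -, rfl⟩ := hP
  have hfin : ((convexHull ℝ s).extremePoints ℝ).Finite := hs.subset extremePoints_convexHull_subset
  have e : convexHull ℝ s = convexHull ℝ ((convexHull ℝ s).extremePoints ℝ) := by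
    rw [← (hfin.isClosed_convexHull ℝ).closure_eq]
    exact (closure_convexHull_extremePoints (hs.isCompact_convexHull ℝ)
      (convex_convexHull ℝ s)).symm
  refine ⟨_, hfin, e, fun x hx => ?_⟩
  have hx' : x ∉ convexHull ℝ ((convexHull ℝ s).extremePoints ℝ \ {x}) := by
    intro hcon
    have h1 : convexHull ℝ ((convexHull ℝ s).extremePoints ℝ \ {x}) ⊆ convexHull ℝ s := by
      conv_rhs => rw [e]
      exact convexHull_mono Set.sdiff_subset
    have h2 := inter_extremePoints_subset_extremePoints_of_subset h1 ⟨hcon, hx⟩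
    exact (extremePoints_convexHull_subset h2).2 rfl
  obtain ⟨f, u, hfx, hfu⟩ := geometric_hahn_banach_point_closed (convex_convexHull ℝ _)
    ((hfin.subset Set.sdiff_subset).isClosed_convexHull ℝ) hx'
  have hlt : ∀ y ∈ (convexHull ℝ s).extremePoints ℝ, y ≠ x → f x < f y := fun y hy hyx =>
    hfx.trans (hfu y (subset_convexHull ℝ _ ⟨hy, hyx⟩))
  have hle : ∀ y ∈ (convexHull ℝ s).extremePoints ℝ, f x ≤ f y := fun y hy => by
    by_cases h : y = x
    · rw [h]
    · exact (hlt y hy h).le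
  have e' : {y ∈ (convexHull ℝ s).extremePoints ℝ | f y = f x} = {x} := by
    ext y
    refine ⟨fun hy => ?_, fun hy => ?_⟩
    · by_contra h
      exact (hlt y hy.1 h).ne' hy.2
    · rw [Set.mem_singleton_iff] at hy
      subst hy
      exact ⟨hx, rfl⟩
  have hs : Supports (convexHull ℝ s) {x} f (f x) := by
    rw [e]
    refine ⟨fun y hy => le_of_mem_convexHull hle hy, ?_⟩
    rw [setOf_mem_convexHull_eq hle, e', convexHull_singleton]
  exact hs.isFace (Set.singleton_nonempty x)

/-- A polytope of dimension `n - 1` that is combinatorially a simplex with `n` vertices is a geometric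
simplex: its vertices correspond to disjoint nonempty subsets of `Fin n`, so there are at most `n` of
them, and by the dimension there are exactly `n` and they are affinely independent. -/
theorem exists_affineIndependent_of_combEquiv [FiniteDimensional ℝ E] {P : Set E}
    (hP : IsPolytope P) {n : ℕ} (hn : pdim P + 1 = n) (h : CombEquiv P (stdSimplex ℝ (Fin n))) :
    ∃ p : Fin n → E, AffineIndependent ℝ p ∧ P = convexHull ℝ (Set.range p) := by
  obtain ⟨φ⟩ := h
  obtain ⟨t, ht, e, hface⟩ := hP.exists_vertices
  obtain ⟨χ⟩ := nonempty_stdSimplex_faceIso n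
  let ψ := φ.trans χ
  have := ht.fintype
  let V : t → {G : Set E // IsExposed ℝ P G} := fun x => ⟨{x.1}, (hface x.1 x.2).1⟩
  have hne : ∀ x, (ψ (V x)).Nonempty := fun x => by
    rw [Set.nonempty_iff_ne_empty]
    intro h0
    have h1 : V x ≤ ⟨∅, isExposed_empty⟩ := by
      rw [← ψ.le_iff_le, h0]
      exact Set.empty_subset _
    exact h1 (Set.mem_singleton x.1)
  choose q hq using hne
  have hinj : Function.Injective q := by
    intro x y hxy
    have hx : ψ.symm {q x} ≤ V x := by
      rw [← ψ.le_iff_le, ψ.apply_symm_apply]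
      exact Set.singleton_subset_iff.2 (hq x)
    have hy : ψ.symm {q x} ≤ V y := by
      rw [← ψ.le_iff_le, ψ.apply_symm_apply, hxy]
      exact Set.singleton_subset_iff.2 (hq y)
    by_contra hne
    have h0 : ψ.symm {q x} ≤ ⟨∅, isExposed_empty⟩ := fun z hz =>
      hne (Subtype.ext ((hx hz).symm.trans (hy hz)))
    have h1 : ψ.symm {q x} ≤ ψ.symm ∅ := h0.trans (Set.empty_subset _)
    rw [ψ.symm.le_iff_le] at h1
    exact h1 (Set.mem_singleton _)
  have hcard : Fintype.card t ≤ n := by simpa using Fintype.card_le_of_injective q hinj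
  have hspan : Module.finrank ℝ (vectorSpan ℝ (Set.range ((↑) : t → E))) = pdim P := by
    rw [Subtype.range_coe, pdim, e, ← direction_affineSpan ℝ (convexHull ℝ t), affineSpan_convexHull,
      direction_affineSpan]
  have htne : Nonempty t := by
    obtain ⟨s, -, hs, rfl⟩ := hP
    obtain ⟨x, hx⟩ := hs
    have hx := subset_convexHull ℝ s hx
    rw [e] at hx
    exact (convexHull_nonempty_iff.1 ⟨x, hx⟩).to_subtype
  have hcard' : Fintype.card t = pdim P + 1 := by
    refine le_antisymm (hcard.trans hn.ge) ?_
    rw [← hspan]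
    exact finrank_vectorSpan_range_add_one_le ℝ _
  have hind := (affineIndependent_iff_finrank_vectorSpan_eq ℝ ((↑) : t → E) hcard').2 hspan
  let ε : Fin n ≃ t := (Fintype.equivFinOfCardEq (hcard'.trans hn)).symm
  refine ⟨fun i => (ε i).1, hind.comp_embedding ε.toEmbedding, ?_⟩
  rw [e]
  congr 1
  rw [show (fun i => ((ε i).1 : E)) = ((↑) : t → E) ∘ ε from rfl, ε.surjective.range_comp,
    Subtype.range_coe]

theorem pdim_convexHull_image {n : ℕ} {p : Fin n → E} (hp : AffineIndependent ℝ p) {A : Set (Fin n)}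
    (hA : A.Nonempty) : pdim (convexHull ℝ (p '' A)) + 1 = A.ncard := by
  classical
  have h1 : pdim (convexHull ℝ (p '' A)) = Module.finrank ℝ (vectorSpan ℝ (p '' A)) := by
    rw [pdim, ← direction_affineSpan, affineSpan_convexHull, direction_affineSpan]
  have hpos : 0 < A.ncard := hA.ncard_pos
  have h2 := hp.finrank_vectorSpan_image_finset (s := A.toFinset) (n := A.ncard - 1)
    (by rw [← Set.ncard_eq_toFinset_card']; omega)
  rw [Finset.coe_image, Set.coe_toFinset] at h2
  omega

/-- A face of a simplex is again combinatorially a simplex. -/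
theorem combEquiv_face [FiniteDimensional ℝ E] {n : ℕ} {p : Fin n → E}
    (hp : AffineIndependent ℝ p) {G : Set E} (hG : IsFace (convexHull ℝ (Set.range p)) G) {k : ℕ} (hk : pdim G + 1 = k) :
    CombEquiv G (stdSimplex ℝ (Fin k)) := by
  classical
  have e := eq_convexHull_image_of_isExposed hG.1
  set A := {i | p i ∈ G}
  have hA : A.Nonempty := by
    have := hG.2
    rw [e] at this
    simpa using this
  have hcard : Fintype.card A = k := by
    rw [← hk, ← Nat.card_eq_fintype_card, Nat.card_coe_set_eq, ← pdim_convexHull_image hp hA, ← e]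
  let ε : Fin k ≃ A := (Fintype.equivFinOfCardEq hcard).symm
  have h2 : AffineIndependent ℝ (fun i => p (ε i).1) :=
    hp.comp_embedding (ε.toEmbedding.trans (Function.Embedding.subtype _))
  have h3 : Set.range (fun i => p (ε i).1) = p '' A := by
    rw [show (fun i => p (ε i).1) = (fun a : A => p a) ∘ ε from rfl, ε.surjective.range_comp,
      Set.image_eq_range]
  rw [e, ← h3]
  exact combEquiv_stdSimplex h2

/-- Two different facets of a simplex of dimension at least two meet in a face of codimension two. -/
theorem pdim_inter_of_facets_simplex {n : ℕ} {p : Fin n → E} (hp : AffineIndependent ℝ p)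
    (hn : 3 ≤ n) {G G' : Set E} (hG : IsFace (convexHull ℝ (Set.range p)) G)
    (hG' : IsFace (convexHull ℝ (Set.range p)) G') (hd : pdim G + 2 = n) (hd' : pdim G' + 2 = n)
    (hne : G ≠ G') : (G ∩ G').Nonempty ∧ pdim (G ∩ G') + 3 = n := by
  have e := eq_convexHull_image_of_isExposed hG.1
  have e' := eq_convexHull_image_of_isExposed hG'.1
  have e'' := eq_convexHull_image_of_isExposed (hG.1.inter hG'.1)
  have hi : {i | p i ∈ G ∩ G'} = {i | p i ∈ G} ∩ {i | p i ∈ G'} := rfl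
  set A := {i | p i ∈ G}
  set A' := {i | p i ∈ G'}
  have hA : A.Nonempty := by
    have := hG.2; rw [e] at this; simpa using this
  have hA' : A'.Nonempty := by
    have := hG'.2; rw [e'] at this; simpa using this
  have c : A.ncard + 1 = n := by rw [← pdim_convexHull_image hp hA, ← e]; omega
  have c' : A'.ncard + 1 = n := by rw [← pdim_convexHull_image hp hA', ← e']; omega
  have hss : A ⊂ A ∪ A' := by
    refine Set.ssubset_iff_subset_ne.2 ⟨Set.subset_union_left, fun h => hne ?_⟩
    have h1 : A' ⊆ A := h ▸ Set.subset_union_right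
    have h2 : A' = A := Set.eq_of_subset_of_ncard_le h1 (by omega)
    rw [e, e', h2]
  have h1 := Set.ncard_lt_ncard hss
  have h2 : (A ∪ A').ncard ≤ n := by
    have := Set.ncard_le_card (A ∪ A')
    simpa using this
  have h3 := Set.ncard_union_add_ncard_inter A A'
  have hI : (A ∩ A').Nonempty := by
    rw [← Set.ncard_pos]; omega
  have h4 := pdim_convexHull_image hp hI
  rw [hi] at e''
  rw [← e''] at h4
  refine ⟨?_, by omega⟩
  rw [e'']
  exact convexHull_nonempty_iff.2 (hI.image p)

end Simplex

section AddPoint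

variable {E : Type*} [NormedAddCommGroup E] [NormedSpace ℝ E]

/-! ### Faces of subsets and points beneath or beyond a face -/

theorem inter_affineSpan_facet {P F S : Set E} (hF : IsFace P F) (hS : S ⊆ P) :
    S ∩ affineSpan ℝ F = S ∩ F := by
  obtain ⟨f, c, hs⟩ := hF.exists_supports
  ext x
  exact ⟨fun hx => ⟨hx.1, hs.mem (hS hx.1) (hs.eq_of_mem_affineSpan hx.2)⟩,
    fun hx => ⟨hx.1, subset_affineSpan ℝ F hx.2⟩⟩

theorem IsFace.inter {P F G : Set E} (hF : IsFace P F) (hG : IsFace P G) (h : (F ∩ G).Nonempty) :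
    IsFace P (F ∩ G) := ⟨hF.1.inter hG.1, h⟩

/-- A face of `P` contained in the subset `F` of `P` is a face of `F`. -/
theorem IsFace.of_subset {P F R : Set E} (hR : IsFace P R) (hF : F ⊆ P) (h : R ⊆ F) :
    IsFace F R := ⟨hR.1.mono hF h, hR.2⟩

theorem inter_mem_facets_of_adj {P F G : Set E} (hF : F ∈ facets P) (hG : G ∈ adj P F) :
    F ∩ G ∈ facets F :=
  ⟨hG.2.1.of_subset hF.1.subset Set.inter_subset_left, by have := hG.2.2; have := hF.2; omega⟩

theorem adj_comm {P F G : Set E} (hF : F ∈ facets P) (hG : G ∈ adj P F) : F ∈ adj P G := by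
  refine ⟨hF, ?_, ?_⟩ <;> rw [Set.inter_comm]
  exacts [hG.2.1, hG.2.2]

theorem posSide_inter {P F G : Set E} {v : E} (hF : F ⊆ P) (hvF : v ∈ affineSpan ℝ F)
    (hv : v ∈ posSide P G) : v ∈ posSide F (F ∩ G) := by
  obtain ⟨-, f, c, hs, hlt⟩ := hv
  exact ⟨hvF, f, c, hs.restrict hF, hlt⟩

theorem negSide_inter {P F G : Set E} {v : E} (hF : F ⊆ P) (hvF : v ∈ affineSpan ℝ F)
    (hv : v ∈ negSide P G) : v ∈ negSide F (F ∩ G) := by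
  obtain ⟨-, f, c, hs, hlt⟩ := hv
  exact ⟨hvF, f, c, hs.restrict hF, hlt⟩

theorem notMem_of_mem_negSide {P F : Set E} {v : E} (hv : v ∈ negSide P F) : v ∉ P := by
  obtain ⟨-, f, c, hs, hlt⟩ := hv
  exact fun hP => (hs.1 v hP).not_gt hlt

/-- A point beyond some facet is a vertex of the hull: it is the unique point where the functional of
that facet is smallest. -/
theorem isFace_singleton_of_mem_negSide {P F : Set E} {v : E} (hv : v ∈ negSide P F) :
    IsFace (hullWith v P) {v} := by
  obtain ⟨-, f, c, hs, hlt⟩ := hv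
  have h0 : Supports P ∅ f (f v) :=
    ⟨fun x hx => hlt.le.trans (hs.1 x hx), by
      ext x
      exact ⟨False.elim, fun ⟨hx, hxv⟩ => (hs.1 x hx).not_gt (hxv ▸ hlt)⟩⟩
  have h1 := h0.hullWith_of_eq (v := v) rfl
  have e : hullWith v (∅ : Set E) = {v} := by
    rw [hullWith, insert_empty_eq, convexHull_singleton]
  rw [e] at h1
  exact h1.isFace (Set.singleton_nonempty v)

theorem notMem_posSide_of_mem_affineSpan {P F : Set E} {v : E}
    (hv : v ∈ affineSpan ℝ F) : v ∉ posSide P F := by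
  rintro ⟨-, f, c, hs, hlt⟩
  exact hlt.ne' (hs.eq_of_mem_affineSpan hv)

theorem notMem_negSide_of_mem_affineSpan {P F : Set E} {v : E}
    (hv : v ∈ affineSpan ℝ F) : v ∉ negSide P F := by
  rintro ⟨-, f, c, hs, hlt⟩
  exact hlt.ne (hs.eq_of_mem_affineSpan hv)

/-! ### The facets of the convex hull of a polytope and a point -/

/-- A functional that attains its maximum over a set at a relative interior point is constant on
the set. -/
theorem eq_of_mem_intrinsicInterior {A : Set E} {f : E →L[ℝ] ℝ} {x : E}
    (hx : x ∈ intrinsicInterior ℝ A) (hmax : ∀ y ∈ A, f y ≤ f x) {y : E} (hy : y ∈ A) :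
    f y = f x := by
  refine le_antisymm (hmax y hy) ?_
  obtain ⟨x', hx', rfl⟩ := mem_intrinsicInterior.1 hx
  -- Move a little from `x` in the direction opposite to `y`, inside the affine span.
  let γ : ℝ → affineSpan ℝ A := fun t =>
    ⟨AffineMap.lineMap (x' : E) y t, AffineMap.lineMap_mem t x'.2 (subset_affineSpan ℝ A hy)⟩
  have hγ : Continuous γ := Continuous.subtype_mk AffineMap.lineMap_continuous _
  have hγ0 : γ 0 = x' := Subtype.ext (by simp [γ])
  have hmem : ∀ᶠ t in nhds (0 : ℝ), γ t ∈ ((↑) ⁻¹' A : Set (affineSpan ℝ A)) := by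
    apply hγ.continuousAt.eventually
    rw [hγ0]
    exact mem_interior_iff_mem_nhds.1 hx'
  obtain ⟨t, ht, htA⟩ : ∃ t < (0 : ℝ), γ t ∈ ((↑) ⁻¹' A : Set (affineSpan ℝ A)) := by
    have h1 : ∀ᶠ t in nhdsWithin (0 : ℝ) (Set.Iio 0), γ t ∈ ((↑) ⁻¹' A : Set (affineSpan ℝ A)) :=
      hmem.filter_mono nhdsWithin_le_nhds
    obtain ⟨t, h2, h3⟩ := (h1.and self_mem_nhdsWithin).exists
    exact ⟨t, h3, h2⟩
  have h1 := hmax _ htA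
  have h2 : f (AffineMap.lineMap (x' : E) y t) = f x' + t * (f y - f x') := by
    simp [AffineMap.lineMap_apply]; ring
  change f (AffineMap.lineMap (x' : E) y t) ≤ f x' at h1
  rw [h2] at h1
  by_contra! hcon
  nlinarith

variable [FiniteDimensional ℝ E]

/-- The relative interior of a facet that `v` lies beyond becomes interior: a hyperplane supporting
the hull there would contain the facet, but `P` and `v` lie on different sides of the facet. -/
theorem intrinsicInterior_facet_subset_interior {P F : Set E} {v : E}
    (hd : pdim P = Module.finrank ℝ E) (hF : F ∈ facets P) (hv : v ∈ negSide P F) :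
    intrinsicInterior ℝ F ⊆ interior (hullWith v P) := by
  intro x hx
  by_contra hxQ
  obtain ⟨h, c, hs⟩ := hF.1.exists_supports
  rw [mem_negSide_iff hd hF hs] at hv
  have hconv : Convex ℝ (hullWith v P) := convex_convexHull ℝ _
  have hPQ := subset_hullWith v P
  have hint : (interior (hullWith v P)).Nonempty := by
    rw [hconv.interior_nonempty_iff_affineSpan_eq_top]
    exact affineSpan_eq_top (pdim_hullWith_eq hd v) ((hF.1.2.mono hF.1.subset).mono hPQ)
  obtain ⟨f, hf⟩ := geometric_hahn_banach_open_point hconv.interior isOpen_interior hxQ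
  have hle : ∀ y ∈ hullWith v P, f y ≤ f x := by
    have h1 : closure (interior (hullWith v P)) ⊆ {y | f y ≤ f x} :=
      closure_minimal (fun y hy => (hf y hy).le) (isClosed_le f.continuous continuous_const)
    rw [hconv.closure_interior_eq_closure_of_nonempty_interior hint] at h1
    exact fun y hy => h1 (subset_closure hy)
  obtain ⟨t, rfl, -⟩ := exists_eq_smul_of_facet hd hF hs fun y hy =>
    eq_of_mem_intrinsicInterior hx (fun z hz => hle z (hPQ (hF.1.subset hz))) hy
  obtain ⟨p, hp, hpc⟩ := hs.exists_lt (by have := hF.2; omega)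
  have hxc : h x = c := hs.eq_of_mem (intrinsicInterior_subset hx)
  have h1 := hle p (hPQ hp)
  have h2 := hle v (mem_hullWith v P)
  simp only [smul_apply, smul_eq_mul, hxc] at h1 h2
  have ht : t = 0 := by
    apply le_antisymm <;> by_contra! hcon <;> nlinarith
  obtain ⟨y, hy⟩ := hint
  have := hf y hy
  simp [ht] at this

theorem facet_hullWith_of_mem_posSide {P F : Set E} {v : E} (hP : IsPolytope P)
    (hd : pdim P = Module.finrank ℝ E) (hF : F ∈ facets P) (hv : v ∈ posSide P F) :
    F ∈ facets (hullWith v P) := by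
  obtain ⟨h, c, hs⟩ := hF.1.exists_supports
  rw [mem_posSide_iff hd hF hs] at hv
  exact ⟨(hs.hullWith_of_lt hP.convex hv).isFace hF.1.2, by rw [hF.2, hd, pdim_hullWith_eq hd]⟩

theorem facet_hullWith_of_mem_affineSpan {P F : Set E} {v : E}
    (hd : pdim P = Module.finrank ℝ E) (hF : F ∈ facets P) (hv : v ∈ affineSpan ℝ F) :
    hullWith v F ∈ facets (hullWith v P) := by
  obtain ⟨h, c, hs⟩ := hF.1.exists_supports
  refine ⟨(hs.hullWith_of_eq (hs.eq_of_mem_affineSpan hv)).isFace ⟨v, mem_hullWith v F⟩, ?_⟩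
  rw [pdim_hullWith_of_mem hv, hF.2, hd, pdim_hullWith_eq hd]

/-- The pyramid with apex `v` over the ridge between a facet that `v` lies beyond and a facet that
`v` lies beneath is a facet of the hull. -/
theorem pyramid_mem_facets {P F G : Set E} {v : E}
    (hd : pdim P = Module.finrank ℝ E) (hF : F ∈ facets P) (hG : G ∈ adj P F)
    (hvF : v ∈ negSide P F) (hvG : v ∈ posSide P G) :
    hullWith v (F ∩ G) ∈ facets (hullWith v P) ∧ IsPyramid (hullWith v (F ∩ G)) (F ∩ G) v := by
  obtain ⟨hG, hR, hRd⟩ := hG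
  obtain ⟨f, b, hf⟩ := hF.1.exists_supports
  obtain ⟨g, c, hg⟩ := hG.1.exists_supports
  rw [mem_negSide_iff hd hF hf] at hvF
  rw [mem_posSide_iff hd hG hg] at hvG
  -- The weights are chosen such that the combined functional is tight at `v`.
  have hs := hf.inter hg (sub_pos.2 hvG) (sub_pos.2 hvF)
  have hsQ := hs.hullWith_of_eq (v := v)
    (by simp only [add_apply, smul_apply, smul_eq_mul]; ring)
  have hdim : pdim (hullWith v (F ∩ G)) = pdim (F ∩ G) + 1 := by
    refine le_antisymm (pdim_hullWith_le v _) ?_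
    exact pdim_lt_pdim (subset_hullWith v _) hR.2 (fun x hx => hf.eq_of_mem hx.1)
      (mem_hullWith v _) hvF.ne
  refine ⟨⟨hsQ.isFace ⟨v, mem_hullWith v _⟩, ?_⟩, fun hv => ?_, rfl⟩
  · rw [pdim_hullWith_eq hd, hdim, ← hd, ← hRd]
  · exact hvF.ne (hf.eq_of_mem_affineSpan (affineSpan_mono ℝ Set.inter_subset_left hv))

/-- Every facet of `conv (P ∪ {v})` is a facet of `P` that `v` lies beneath, the hull of `v` and a
facet of `P` whose hyperplane contains `v`, or a pyramid with apex `v` over the ridge between a facet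
that `v` lies beyond and one that `v` lies beneath. -/
theorem facets_hullWith_cases {P G : Set E} {v : E} (hP : IsPolytope P)
    (hd : pdim P = Module.finrank ℝ E) (h2 : 2 ≤ Module.finrank ℝ E)
    (hG : G ∈ facets (hullWith v P)) :
    (G ∈ facets P ∧ v ∈ posSide P G) ∨
    (∃ F ∈ facets P, v ∈ affineSpan ℝ F ∧ G = hullWith v F) ∨
    (∃ F₁ ∈ facets P, ∃ F₂ ∈ adj P F₁, v ∈ negSide P F₁ ∧ v ∈ posSide P F₂ ∧
      G = hullWith v (F₁ ∩ F₂)) := by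
  have hdQ := pdim_hullWith_eq hd v
  have hGd : pdim G + 1 = Module.finrank ℝ E := hG.2.trans hdQ
  obtain ⟨g, c, hg⟩ := hG.1.exists_supports
  have hgP : Supports P {x ∈ P | g x = c} g c :=
    ⟨fun x hx => hg.1 x (subset_hullWith v P hx), rfl⟩
  rcases (hg.1 v (mem_hullWith v P)).lt_or_eq with hv | hv
  · left
    have e : G = {x ∈ P | g x = c} := hg.2.trans (hgP.hullWith_of_lt hP.convex hv).2.symm
    rw [← e] at hgP
    have hGP : G ∈ facets P := ⟨hgP.isFace hG.1.2, hGd.trans hd.symm⟩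
    exact ⟨hGP, (mem_posSide_iff hd hGP hgP v).2 hv⟩
  · right
    have e : G = hullWith v {x ∈ P | g x = c} := hg.2.trans (hgP.hullWith_of_eq hv.symm).2.symm
    set R := {x ∈ P | g x = c}
    have hRne : R.Nonempty := by
      rw [Set.nonempty_iff_ne_empty]
      intro h0
      rw [h0, hullWith, insert_empty_eq, convexHull_singleton] at e
      rw [e, pdim, vectorSpan_singleton, finrank_bot] at hGd
      omega
    have hR := hgP.isFace hRne
    have hle := pdim_hullWith_le v R
    have hge := pdim_mono (subset_hullWith v R)
    rw [← e] at hle hge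
    by_cases hRd : pdim R + 1 = Module.finrank ℝ E
    · left
      have hRf : R ∈ facets P := ⟨hR, hRd.trans hd.symm⟩
      exact ⟨R, hRf, (mem_affineSpan_facet_iff hd hRf hgP v).2 hv.symm, e⟩
    right
    have hRd : pdim R + 2 = Module.finrank ℝ E := by omega
    obtain ⟨F₁, F₂, f₁, f₂, c₁, c₂, hF₁, hF₂, hs₁, hs₂, hRF, hcone⟩ :=
      exists_two_facets hP hd hR hRd
    obtain ⟨a, b, ha, hb, eg, ec⟩ := hcone g c hgP.1 fun x hx => hgP.eq_of_mem hx
    -- A facet whose functional is proportional to `g` would be contained in the ridge `R`.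
    have hnot : ∀ F ∈ facets P, ¬ F ⊆ R := fun F hF hFR => by
      have := pdim_mono hFR
      have := hF.2
      omega
    have ha : 0 < a := by
      refine ha.lt_of_ne ?_
      rintro rfl
      refine hnot F₂ hF₂ fun x hx => hgP.mem (hs₂.subset hx) ?_
      rw [eg, ec, ← hs₂.eq_of_mem hx]; simp
    have hb : 0 < b := by
      refine hb.lt_of_ne ?_
      rintro rfl
      refine hnot F₁ hF₁ fun x hx => hgP.mem (hs₁.subset hx) ?_
      rw [eg, ec, ← hs₁.eq_of_mem hx]; simp
    have hsum : a * (f₁ v - c₁) + b * (f₂ v - c₂) = 0 := by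
      rw [eg, ec] at hv
      simp only [add_apply, smul_apply, smul_eq_mul] at hv
      linarith
    have hne : f₁ v ≠ c₁ := by
      intro h1
      have hall : ∀ x ∈ G, f₁ x = c₁ := by
        rw [e]
        refine fun x hx => convexHull_min (t := {x | f₁ x = c₁}) ?_
          (convex_hyperplane f₁.toLinearMap.isLinear c₁) hx
        rintro y (rfl | hy)
        · exact h1
        · exact hs₁.eq_of_mem (hRF ▸ hy : y ∈ F₁ ∩ F₂).1
      obtain ⟨t, et, ect⟩ := exists_eq_smul_of_facet hdQ hG hg hall
      have ht : t ≠ 0 := by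
        rintro rfl
        exact ne_zero_of_facet hF₁ hs₁ (by rw [et, zero_smul])
      refine hnot F₁ hF₁ fun x hx => hgP.mem (hs₁.subset hx) (mul_left_cancel₀ ht ?_)
      rw [← ect, ← hs₁.eq_of_mem hx, et]
      rfl
    rcases hne.lt_or_gt with h1 | h1
    · have h2 : c₂ < f₂ v := by
        have := mul_pos ha (sub_pos.2 h1)
        by_contra! hcon
        have := mul_nonneg hb.le (sub_nonneg.2 hcon)
        linarith
      exact ⟨F₁, hF₁, F₂, ⟨hF₂, hRF ▸ hR, by rw [← hRF, hRd, hd]⟩,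
        (mem_negSide_iff hd hF₁ hs₁ v).2 h1, (mem_posSide_iff hd hF₂ hs₂ v).2 h2, hRF ▸ e⟩
    · have h2 : f₂ v < c₂ := by
        have := mul_pos ha (sub_pos.2 h1)
        by_contra! hcon
        have := mul_nonneg hb.le (sub_nonneg.2 hcon)
        linarith
      rw [Set.inter_comm] at hRF
      exact ⟨F₂, hF₂, F₁, ⟨hF₁, hRF ▸ hR, by rw [← hRF, hRd, hd]⟩,
        (mem_negSide_iff hd hF₂ hs₂ v).2 h2, (mem_posSide_iff hd hF₁ hs₁ v).2 h1, hRF ▸ e⟩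

theorem notMem_negSide_of_mem_posSide {P F : Set E} {v : E} (hd : pdim P = Module.finrank ℝ E)
    (hF : F ∈ facets P) (hv : v ∈ posSide P F) : v ∉ negSide P F := by
  obtain ⟨f, c, hs⟩ := hF.1.exists_supports
  rw [mem_posSide_iff hd hF hs] at hv
  rw [mem_negSide_iff hd hF hs]
  exact hv.not_gt

/-! ### The facets of a facet -/

/-- A facet of a facet `F` is the ridge between `F` and an adjacent facet. -/
theorem exists_adj_of_mem_facets_facet {P F R : Set E} (hP : IsPolytope P)
    (hd : pdim P = Module.finrank ℝ E) (hF : F ∈ facets P) (hR : R ∈ facets F) :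
    ∃ G ∈ adj P F, R = F ∩ G := by
  have hRP : IsFace P R := IsFace.trans hP hF.1 hR.1
  have hRd : pdim R + 2 = pdim P := by have := hF.2; have := hR.2; omega
  obtain ⟨F₁, F₂, -, e, h⟩ := exists_two_facets_iff hP hd hRP (hRd.trans hd)
  rcases (h F).1 ⟨hF, hR.1.subset⟩ with rfl | rfl
  · exact ⟨F₂, ⟨((h F₂).2 (Or.inr rfl)).1, e ▸ hRP, e ▸ hRd⟩, e⟩
  · rw [Set.inter_comm] at e
    exact ⟨F₁, ⟨((h F₁).2 (Or.inl rfl)).1, e ▸ hRP, e ▸ hRd⟩, e⟩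

/-- Different facets adjacent to `S` share different ridges with `S`. -/
theorem inter_ne_inter_of_adj {P S F G : Set E} (hP : IsPolytope P)
    (hd : pdim P = Module.finrank ℝ E) (hS : S ∈ facets P) (hF : F ∈ adj P S) (hG : G ∈ adj P S)
    (hne : F ≠ G) : S ∩ F ≠ S ∩ G := by
  intro e
  have hSF : ∀ H ∈ adj P S, H ≠ S := by
    rintro H hH rfl
    have h1 := hH.2.2
    rw [Set.inter_self] at h1
    have := hS.2
    omega
  obtain ⟨F₁, F₂, -, -, h⟩ := exists_two_facets_iff hP hd hF.2.1 (hF.2.2.trans hd)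
  have h1 := (h S).1 ⟨hS, Set.inter_subset_left⟩
  have h2 := (h F).1 ⟨hF.1, Set.inter_subset_right⟩
  have h3 := (h G).1 ⟨hG.1, e ▸ Set.inter_subset_right⟩
  have h4 := hSF F hF
  have h5 := hSF G hG
  grind

/-- Two different facets adjacent to a simplex facet `S` meet `S` in a common face of codimension
three. -/
theorem isFace_inter_of_adj_simplex {P S F G : Set E} (hP : IsPolytope P)
    (hd : pdim P = Module.finrank ℝ E) (h3 : 3 ≤ pdim P) (hS : IsSimplexFacet P S)
    (hF : F ∈ adj P S) (hG : G ∈ adj P S) (hne : F ≠ G) :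
    IsFace P ((S ∩ F) ∩ (S ∩ G)) ∧ pdim ((S ∩ F) ∩ (S ∩ G)) + 3 = pdim P := by
  obtain ⟨p, hp, e⟩ :=
    exists_affineIndependent_of_combEquiv (hS.1.1.isPolytope hP) hS.1.2 hS.2
  have key : ∀ H ∈ adj P S, IsFace (convexHull ℝ (Set.range p)) (S ∩ H) := fun H hH =>
    e ▸ hH.2.1.of_subset hS.1.1.subset Set.inter_subset_left
  obtain ⟨h1, h2⟩ := pdim_inter_of_facets_simplex hp h3 (key F hF) (key G hG) hF.2.2 hG.2.2
    (inter_ne_inter_of_adj hP hd hS.1 hF hG hne)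
  exact ⟨hF.2.1.inter hG.2.1 h1, h2⟩

/-- The facet of a simplex facet `S` cut out by an adjacent facet `F` is a simplex facet of `F`. -/
theorem isSimplexFacet_inter {P S F : Set E} (hP : IsPolytope P)
    (hS : IsSimplexFacet P S) (hF : F ∈ adj P S) : IsSimplexFacet F (S ∩ F) := by
  obtain ⟨p, hp, e⟩ :=
    exists_affineIndependent_of_combEquiv (hS.1.1.isPolytope hP) hS.1.2 hS.2
  have h1 : S ∩ F ∈ facets F := by
    rw [Set.inter_comm]
    exact inter_mem_facets_of_adj hF.1 (adj_comm hS.1 hF)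
  have h2 : IsFace (convexHull ℝ (Set.range p)) (S ∩ F) :=
    e ▸ hF.2.1.of_subset hS.1.1.subset Set.inter_subset_left
  exact ⟨h1, combEquiv_face hp h2 h1.2⟩

/-- Inside the hyperplane of a facet `F ∈ 𝓕` a pseudo-stacking of `P` is a pseudo-stacking of `F`.
As `S` is a simplex, nonsimplicity means that no two facets in `𝓕` are adjacent; so `v` lies strictly
beneath or beyond each facet of `F`. -/
theorem IsPseudoStacking.facet {P S Q : Set E} {𝓕 𝓝 : Set (Set E)} {v : E}
    (h : IsPseudoStacking P S 𝓕 𝓝 v Q) (hd : pdim P = Module.finrank ℝ E) (h3 : 3 ≤ pdim P)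
    (hns : IsNonsimple P S 𝓕) {F : Set E} (hF : F ∈ 𝓕) :
    IsPseudoStacking F (S ∩ affineSpan ℝ F) ∅ {R | R ∈ facets F ∧ ∃ N ∈ 𝓝, R = N ∩ F} v
      (hullWith v F) := by
  obtain ⟨hP, hS, h𝓕, h𝓝, hdisj, ⟨-, hpos, hzero, hneg, hvS⟩, -⟩ := h
  have hFS := h𝓕 hF
  have hFf := hFS.1
  have hvF := hzero F hF
  have hFP := hFf.1.subset
  rw [inter_affineSpan_facet hFf.1 hS.1.1.subset]
  refine ⟨hFf.1.isPolytope hP, isSimplexFacet_inter hP hS hFS, Set.empty_subset _, ?_,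
    Set.empty_disjoint _, ⟨hvF, ?_, fun _ h => h.elim, ?_, ?_⟩, rfl⟩
  · rintro _ ⟨hR, N, hN, rfl⟩
    have hne : F ≠ N := fun e => hdisj.le_bot ⟨hF, e ▸ hN⟩
    obtain ⟨h1, h2⟩ := isFace_inter_of_adj_simplex hP hd h3 hS hFS (h𝓝 hN) hne
    have e : (S ∩ F) ∩ (S ∩ N) = S ∩ F ∩ (N ∩ F) := by
      ext x; simp only [Set.mem_inter_iff]; tauto
    rw [e] at h1 h2
    refine ⟨hR, h1.of_subset hFP fun x hx => hx.1.2, ?_⟩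
    have := hFf.2
    omega
  · intro R hR _ hRN hRS
    obtain ⟨G, hG, rfl⟩ := exists_adj_of_mem_facets_facet hP hd hFf hR
    refine posSide_inter hFP hvF (hpos G hG.1 ?_ ?_ ?_)
    · intro hG𝓕
      have hne : F ≠ G := by
        rintro rfl
        have h1 := hR.2
        rw [Set.inter_self] at h1
        omega
      obtain ⟨h1, h2⟩ := isFace_inter_of_adj_simplex hP hd h3 hS hFS (h𝓕 hG𝓕) hne
      exact hns ⟨F, hF, G, hG𝓕, hG, _, h1, h2, fun x hx => hx.1.1, fun x hx => hx.1.2,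
        fun x hx => hx.2.2⟩
    · exact fun hG𝓝 => hRN ⟨hR, G, hG𝓝, Set.inter_comm _ _⟩
    · rintro rfl
      exact hRS (Set.inter_comm _ _)
  · rintro _ ⟨-, N, hN, rfl⟩
    rw [Set.inter_comm]
    exact negSide_inter hFP hvF (hneg N hN)
  · rw [Set.inter_comm]
    exact negSide_inter hFP hvF hvS

end AddPoint

end PseudoStack

theorem proposition2p6 (d : ℕ) (hd : 3 ≤ d)
    (P S : Set (EuclideanSpace ℝ (Fin d))) (𝓕 𝓝 : Set (Set (EuclideanSpace ℝ (Fin d))))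
    (v : EuclideanSpace ℝ (Fin d)) (Q : Set (EuclideanSpace ℝ (Fin d)))
    (hdim : pdim P = d) (hbdd : InBoundedPosition P S) (hns : IsNonsimple P S 𝓕)
    (hQ : IsPseudoStacking P S 𝓕 𝓝 v Q) :
    -- `v` is a vertex of `Q` and not a point of `P`
    (v ∉ P ∧ IsFace Q {v}) ∧
    -- the relative interiors of `S` and of the facets in `𝓝` become interior
    (intrinsicInterior ℝ S ⊆ interior Q ∧ ∀ N ∈ 𝓝, intrinsicInterior ℝ N ⊆ interior Q) ∧
    -- (a) the facets that remain unchanged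
    (∀ F ∈ facets P \ ({S} ∪ 𝓝 ∪ 𝓕), F ∈ facets Q) ∧
    -- (b) pyramids over the ridges between `S` and the other adjacent facets
    (∀ F ∈ adj P S \ (𝓕 ∪ 𝓝),
      hullWith v (S ∩ F) ∈ facets Q \ facets P ∧ IsPyramid (hullWith v (S ∩ F)) (S ∩ F) v) ∧
    -- (c) pyramids over the ridges between a facet in `𝓝` and one of the other facets
    (∀ N ∈ 𝓝, ∀ F ∈ facets P \ (𝓕 ∪ 𝓝 ∪ {S}), F ∈ adj P N →
      hullWith v (N ∩ F) ∈ facets Q \ facets P ∧ IsPyramid (hullWith v (N ∩ F)) (N ∩ F) v) ∧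
    -- (d) the facets in `𝓕` are pseudo-stacked inside their hyperplanes
    (∀ F ∈ 𝓕, hullWith v F ∈ facets Q ∧
      IsPseudoStacking F (S ∩ affineSpan ℝ F) ∅ {R | R ∈ facets F ∧ ∃ N ∈ 𝓝, R = N ∩ F} v
        (hullWith v F)) ∧
    -- there are no other facets
    (∀ G ∈ facets Q,
      G ∈ facets P \ ({S} ∪ 𝓝 ∪ 𝓕) ∨
      (∃ F ∈ adj P S \ (𝓕 ∪ 𝓝), G = hullWith v (S ∩ F)) ∨
      (∃ N ∈ 𝓝, ∃ F ∈ facets P \ (𝓕 ∪ 𝓝 ∪ {S}), F ∈ adj P N ∧ G = hullWith v (N ∩ F)) ∨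
      (∃ F ∈ 𝓕, G = hullWith v F)) := by
  have hd' : pdim P = Module.finrank ℝ (EuclideanSpace ℝ (Fin d)) := by
    rw [hdim, finrank_euclideanSpace_fin]
  have hst := hQ
  obtain ⟨hP, hS, h𝓕, h𝓝, hdisj, ⟨-, hpos, hzero, hneg, hvS⟩, rfl⟩ := hQ
  have hvP := notMem_of_mem_negSide hvS
  have hnew : ∀ R, hullWith v R ∉ facets P := fun R hR => hvP (hR.1.subset (mem_hullWith v R))
  -- The facets that `v` lies beyond are `S` and those in `𝓝`; those it lies beneath are outside
  -- `{S} ∪ 𝓕 ∪ 𝓝`.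
  have hposne : ∀ F ∈ facets P, v ∈ posSide P F → F ∉ 𝓕 ∧ F ∉ 𝓝 ∧ F ≠ S := fun F hF hv =>
    ⟨fun h => notMem_posSide_of_mem_affineSpan (hzero F h) hv,
      fun h => notMem_negSide_of_mem_posSide hd' hF hv (hneg F h),
      fun h => notMem_negSide_of_mem_posSide hd' hF hv (h ▸ hvS)⟩
  have hSadj : ∀ F ∈ adj P S, F ≠ S := by
    rintro F hF rfl
    have h1 := hF.2.2
    rw [Set.inter_self] at h1
    have := hS.1.2
    omega
  refine ⟨⟨hvP, isFace_singleton_of_mem_negSide hvS⟩,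
    ⟨intrinsicInterior_facet_subset_interior hd' hS.1 hvS, fun N hN =>
      intrinsicInterior_facet_subset_interior hd' (h𝓝 hN).1 (hneg N hN)⟩, ?_, ?_, ?_, ?_, ?_⟩
  · rintro F ⟨hF, hF'⟩
    simp only [Set.mem_union, Set.mem_singleton_iff, not_or] at hF'
    exact facet_hullWith_of_mem_posSide hP hd' hF (hpos F hF hF'.2 hF'.1.2 hF'.1.1)
  · rintro F ⟨hF, hF'⟩
    rw [Set.mem_union, not_or] at hF'
    have h1 := pyramid_mem_facets hd' hS.1 hF hvS (hpos F hF.1 hF'.1 hF'.2 (hSadj F hF))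
    exact ⟨⟨h1.1, hnew _⟩, h1.2⟩
  · rintro N hN F ⟨hF, hF'⟩ hFN
    simp only [Set.mem_union, Set.mem_singleton_iff, not_or] at hF'
    have h1 := pyramid_mem_facets hd' (h𝓝 hN).1 hFN (hneg N hN)
      (hpos F hF hF'.1.1 hF'.1.2 hF'.2)
    exact ⟨⟨h1.1, hnew _⟩, h1.2⟩
  · exact fun F hF => ⟨facet_hullWith_of_mem_affineSpan hd' (h𝓕 hF).1 (hzero F hF),
      hst.facet hd' (hdim.symm ▸ hd) hns hF⟩
  · intro G hG
    rcases facets_hullWith_cases hP hd' (by rw [← hd']; omega) hG with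
      ⟨hGP, hv⟩ | ⟨F, hF, hv, rfl⟩ | ⟨F₁, hF₁, F₂, hF₂, hv₁, hv₂, rfl⟩
    · left
      have := hposne G hGP hv
      refine ⟨hGP, ?_⟩
      simp only [Set.mem_union, Set.mem_singleton_iff]
      tauto
    · refine Or.inr (Or.inr (Or.inr ⟨F, ?_, rfl⟩))
      by_contra hF𝓕
      refine notMem_posSide_of_mem_affineSpan hv (hpos F hF hF𝓕 (fun h => ?_) fun h => ?_)
      · exact notMem_negSide_of_mem_affineSpan hv (hneg F h)
      · exact notMem_negSide_of_mem_affineSpan hv (h ▸ hvS)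
    · obtain ⟨h1, h2, h3⟩ := hposne F₂ hF₂.1 hv₂
      by_cases hF₁S : F₁ = S
      · subst hF₁S
        exact Or.inr (Or.inl ⟨F₂, ⟨hF₂, fun h => h.elim h1 h2⟩, rfl⟩)
      · have hF₁𝓝 : F₁ ∈ 𝓝 := by
          by_contra hF₁𝓝
          have hF₁𝓕 : F₁ ∉ 𝓕 := fun h => notMem_negSide_of_mem_affineSpan (hzero F₁ h) hv₁
          exact notMem_negSide_of_mem_posSide hd' hF₁ (hpos F₁ hF₁ hF₁𝓕 hF₁𝓝 hF₁S) hv₁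
        refine Or.inr (Or.inr (Or.inl ⟨F₁, hF₁𝓝, F₂, ⟨hF₂.1, ?_⟩, hF₂, rfl⟩))
        simp only [Set.mem_union, Set.mem_singleton_iff]
        tauto
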